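/- Let $\mathbb F$ be a finite field with $q$ elements, $A=\mathbb F[t]$, and let $F$ be a finite $A$-field: a finite field extension of $\mathbb F$ with an $\mathbb F$-algebra homomorphism $\gamma:A\to F$. Let $\mathfrak p$ be the monic generator of $\ker\gamma$ and assume that $d:=\deg\mathfrak p=[F:\mathbb F]$ (that is, $\gamma$ is surjective). Unlabelled tensor products are over $\mathbb F$. Put $A_F=A\otimes F=F[t]$ and $\theta=\gamma(t)\in F\subset A_F$, and let $\tau:A_F\to A_F$ be the identity on $A$ and $x\mapsto x^q$ on $F$. For an $A_F$-module $M$ write $\tau^*M=A_F\otimes_{\tau,A_F}M$. *Anderson motives.* An Anderson motive over $F$ is a finite free $A_F$-module $M$ with an $A_F$-linear isomorphism $\tau_M:(\tau^*M)[\frac1{t-\theta}]\to M[\frac1{t-\theta}]$. Its dual is $M^\vee=\mathrm{Hom}_{A_F}(M,A_F)$ with $\tau_{M^\vee}(f)=f\circ\tau_M^{-1}$, under the identification $\tau^*M^\vee=\mathrm{Hom}_{A_F}(\tau^*M,A_F)$. Since $t-\theta$ divides $\mathfrak p$ in $A_F$, $\tau_M$ induces a $\tau$-semilinear endomorphism of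 $A[\frac1{\mathfrak p}]\otimes_AM$, whose $d$-th iterate $\tau_M^d$ is linear. The Euler factor of $M$ is $$P(M;T)=\det\nolimits_{A[\frac1{\mathfrak p},T]\otimes F}\big(1-T^d\tau_M^d\,\big|\,A[\tfrac1{\mathfrak p},T]\otimes_AM\big).$$ *Drinfeld modules.* Let $F\{\tau\}$ be the ring of twisted polynomials, with $\tau x=x^q\tau$ for $x\in F$. A Drinfeld module over $F$ of rank $r\ge1$ is an $\mathbb F$-algebra homomorphism $\phi:A\to F\{\tau\}$, $a\mapsto\phi_a$, with $\phi_t=\gamma(t)+g_1\tau+\dots+g_r\tau^r$ and $g_r\ne0$. Its Anderson motive $\mathrm M(\phi)$ is $F\{\tau\}$ with $A_F$-module structure $(a\otimes x)\bullet f=xf\phi_a$, and with $\tau_{\mathrm M(\phi)}$ induced by left multiplication by $\tau$. *The $T$-twisted module.* Let $\phi^\sim(F)$ be the $A[T]$-module $F[T]=\mathbb F[T]\otimes F$ on which $t$ acts as $\phi^\sim_t=\gamma(t)+g_1T\tau+\dots+g_rT^r\tau^r$, where $\tau$ is the $q$-power map on $F$ and commutes with $T$. Put $|\phi^\sim(F)|=\det_{A[T]}\big(t-\phi^\sim_t\,\big|\,A\otimes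 F[T]\big)\in A[T]$. Then, for every Drinfeld module $\phi$ over $F$: 1. the (zeroth) Fitting ideal of the $A[T]$-module $\phi^\sim(F)$ is the principal ideal generated by $|\phi^\sim(F)|$; 2. $P\big(\mathrm M(\phi)^\vee;T\big)=\mathfrak p^{-1}\cdot|\phi^\sim(F)|$; in particular $P(\mathrm M(\phi)^\vee;T)$ has coefficients in $A[\frac1{\mathfrak p}]$; 3. the characteristic polynomial of Frobenius $\det_{A_F[T]}\big(T^d-\tau_{\mathrm M(\phi)}^d\,\big|\,\mathrm M(\phi)[T]\big)$ generates, in $A_F[T]$, the extension of the Fitting ideal of $\phi^\sim(F)$. -/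

import Mathlib

open Polynomial TensorProduct

noncomputable section

namespace Drinfeld

/-! ### Base change along a ring homomorphism -/

/-- Given a ring homomorphism `σ : S → S'`, an `R`-algebra structure on `S` and an additive map
`g : M → N` from an `R`-module to an `S'`-module with `g (r • m) = σ r • g m`, the `σ`-semilinear
map `S ⊗_R M → N`, `s ⊗ m ↦ σ s • g m`. -/
def extendSemilinear {R S S' M N : Type*} [CommRing R] [CommRing S] [CommRing S'] [Algebra R S]
    [AddCommGroup M] [Module R M] [AddCommGroup N] [Module S' N] (σ : S →+* S') (g : M →+ N)
    (hg : ∀ (r : R) (m : M), g (r • m) = σ (algebraMap R S r) • g m) :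
    S ⊗[R] M →ₛₗ[σ] N where
  toFun := TensorProduct.liftAddHom
    (AddMonoidHom.mk' (fun s => (DistribSMul.toAddMonoidHom N (σ s)).comp g)
      (fun a b => by ext m; simp [add_smul]))
    (fun r s m => by
      change σ (r • s) • g m = σ s • g (r • m)
      rw [hg, Algebra.smul_def, map_mul, mul_comm, mul_smul])
  map_add' x y := map_add _ x y
  map_smul' s x := by
    induction x using TensorProduct.induction_on with
    | zero => simp
    | tmul t m => simp [TensorProduct.smul_tmul', TensorProduct.liftAddHom_tmul, mul_smul]
    | add x y hx hy => rw [smul_add, map_add, hx, hy, map_add, smul_add]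

@[simp]
theorem extendSemilinear_tmul {R S S' M N : Type*} [CommRing R] [CommRing S] [CommRing S']
    [Algebra R S] [AddCommGroup M] [Module R M] [AddCommGroup N] [Module S' N] (σ : S →+* S')
    (g : M →+ N) (hg : ∀ (r : R) (m : M), g (r • m) = σ (algebraMap R S r) • g m) (s : S) (m : M) :
    extendSemilinear σ g hg (s ⊗ₜ[R] m) = σ s • g m :=
  rfl

section Pullback

variable {R S : Type*} [CommRing R] [CommRing S] (f : R →+* S)
variable (M : Type*) [AddCommGroup M] [Module R M]

/-- The module `S ⊗_R M`, where `S` is seen as an `R`-algebra through `f`. -/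
def Pullback : Type _ :=
  letI : Algebra R S := f.toAlgebra
  S ⊗[R] M

instance Pullback.instAddCommGroup : AddCommGroup (Pullback f M) :=
  letI : Algebra R S := f.toAlgebra
  (TensorProduct.addCommGroup : AddCommGroup (S ⊗[R] M))

instance Pullback.instModule : Module S (Pullback f M) :=
  letI : Algebra R S := f.toAlgebra
  (TensorProduct.leftModule : Module S (S ⊗[R] M))

instance Pullback.instFree [Module.Free R M] : Module.Free S (Pullback f M) :=
  letI : Algebra R S := f.toAlgebra
  (Module.Free.tensor : Module.Free S (S ⊗[R] M))

instance Pullback.instFinite [Module.Finite R M] : Module.Finite S (Pullback f M) :=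
  letI : Algebra R S := f.toAlgebra
  (Module.Finite.base_change R S M : Module.Finite S (S ⊗[R] M))

variable {M}

/-- The canonical `f`-semilinear map `M → S ⊗_R M`, `m ↦ 1 ⊗ m`. -/
def Pullback.mk : M →ₛₗ[f] Pullback f M where
  toFun m := letI : Algebra R S := f.toAlgebra; (1 : S) ⊗ₜ[R] m
  map_add' x y := by
    let : Algebra R S := f.toAlgebra
    exact TensorProduct.tmul_add (1 : S) x y
  map_smul' r x := by
    let : Algebra R S := f.toAlgebra
    change (1 : S) ⊗ₜ[R] (r • x) = (f r) • ((1 : S) ⊗ₜ[R] x)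
    rw [← TensorProduct.smul_tmul, TensorProduct.smul_tmul', Algebra.smul_def, smul_eq_mul]
    rfl

variable {f}

theorem Pullback.induction {motive : Pullback f M → Prop} (z : Pullback f M)
    (hz : motive 0) (ht : ∀ (s : S) (m : M), motive (s • Pullback.mk f m))
    (ha : ∀ x y, motive x → motive y → motive (x + y)) : motive z := by
  let : Algebra R S := f.toAlgebra
  induction z using TensorProduct.induction_on with
  | zero => exact hz
  | tmul s m =>
    have h := ht s m
    have e : s • Pullback.mk f m = (s ⊗ₜ[R] m : S ⊗[R] M) := by
      change s • ((1 : S) ⊗ₜ[R] m) = s ⊗ₜ[R] m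
      rw [TensorProduct.smul_tmul', smul_eq_mul, mul_one]
    rw [e] at h
    exact h
  | add x y hx hy => exact ha x y hx hy

/-- The `S`-linear map `S ⊗_R M → N` attached to an `f`-semilinear map `M → N`. -/
def Pullback.lift {N : Type*} [AddCommGroup N] [Module S N] (g : M →ₛₗ[f] N) :
    Pullback f M →ₗ[S] N :=
  letI : Algebra R S := f.toAlgebra
  (extendSemilinear (R := R) (RingHom.id S) g.toAddMonoidHom
    (fun r m => map_smulₛₗ g r m) : S ⊗[R] M →ₗ[S] N)

@[simp]
theorem Pullback.lift_mk {N : Type*} [AddCommGroup N] [Module S N] (g : M →ₛₗ[f] N) (m : M) :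
    Pullback.lift g (Pullback.mk f m) = g m := by
  let : Algebra R S := f.toAlgebra
  exact one_smul S (g m)

variable (f M)

/-- For `M` finite free, the canonical identification
`S ⊗_R Hom_R(M, R) ≃ Hom_S(S ⊗_R M, S)`, sending `s ⊗ h` to `s' ⊗ m ↦ s * s' * f (h m)`. -/
def Pullback.dualEquiv [Module.Free R M] [Module.Finite R M] :
    Pullback f (Module.Dual R M) ≃ₗ[S] Module.Dual S (Pullback f M) :=
  letI : Algebra R S := f.toAlgebra
  (TensorProduct.isBaseChange R M S).toDualBaseChange

theorem Pullback.dualEquiv_mk [Module.Free R M] [Module.Finite R M] (h : Module.Dual R M) (m : M) :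
    Pullback.dualEquiv f M (Pullback.mk f h) (Pullback.mk f m) = f (h m) := by
  let : Algebra R S := f.toAlgebra
  have := (TensorProduct.isBaseChange R M S).toDualBaseChange_tmul 1 h m
  rw [one_mul] at this
  exact this

end Pullback

/-! ### Twisted polynomials -/

section Twisted

set_option linter.unusedSectionVars false

variable (𝔽 F : Type*) [Field 𝔽] [Fintype 𝔽] [Field F] [Algebra 𝔽 F]

/-- The action of `ℕ` on `F` for which `1` acts by the `q`-power Frobenius, `q = #𝔽`. -/
@[reducible]
def frobeniusAction : MulSemiringAction (Multiplicative ℕ) F :=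
  MulSemiringAction.compHom F
    (powersHom (F →+* F) (FiniteField.frobeniusAlgHom 𝔽 F : F →+* F))

/-- The ring `F{τ}` of twisted polynomials, with `τ c = c ^ q τ` for `c ∈ F`, `q = #𝔽`. -/
@[nolint unusedArguments]
def TwistedPolynomial (_𝔽 F : Type*) [Field F] : Type _ := SkewPolynomial F

namespace TwistedPolynomial

instance instRing : Ring (TwistedPolynomial 𝔽 F) :=
  letI : MulSemiringAction (Multiplicative ℕ) F := frobeniusAction 𝔽 F
  (SkewPolynomial.instRing : Ring (SkewPolynomial F))

/-- Left multiplication by scalars of `F`. -/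
instance instModule : Module F (TwistedPolynomial 𝔽 F) :=
  (inferInstance : Module F (SkewPolynomial F))

variable {𝔽 F}

/-- The coefficient of `τ ^ n`. -/
def coeff (f : TwistedPolynomial 𝔽 F) (n : ℕ) : F := SkewPolynomial.coeff f n

variable (𝔽) in
/-- The monomial `a τ ^ n`. -/
def monomial (n : ℕ) (a : F) : TwistedPolynomial 𝔽 F := SkewPolynomial.monomial n a

@[ext] theorem ext {f g : TwistedPolynomial 𝔽 F} (h : ∀ n, f.coeff n = g.coeff n) : f = g :=
  SkewPolynomial.ext h

@[simp] theorem coeff_zero (n : ℕ) : coeff (0 : TwistedPolynomial 𝔽 F) n = 0 := rfl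

@[simp] theorem coeff_add (f g : TwistedPolynomial 𝔽 F) (n : ℕ) :
    (f + g).coeff n = f.coeff n + g.coeff n :=
  SkewPolynomial.coeff_add f g n

@[simp] theorem coeff_smul (a : F) (f : TwistedPolynomial 𝔽 F) (n : ℕ) :
    (a • f).coeff n = a * f.coeff n := rfl

theorem coeff_monomial (n m : ℕ) (a : F) :
    (monomial 𝔽 n a).coeff m = if n = m then a else 0 :=
  SkewPolynomial.coeff_monomial

@[elab_as_elim]
theorem induction {motive : TwistedPolynomial 𝔽 F → Prop} (f : TwistedPolynomial 𝔽 F)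
    (hz : motive 0) (ha : ∀ f g, motive f → motive g → motive (f + g))
    (hm : ∀ n a, motive (monomial 𝔽 n a)) : motive f :=
  SkewPolynomial.induction (motive := motive) f hz
    (fun n r q _ _ hq => ha (monomial 𝔽 n r) q (hm n r) hq)

/-- Induction over twisted polynomials without constant term. -/
theorem induction_coeff_zero {motive : TwistedPolynomial 𝔽 F → Prop} {f : TwistedPolynomial 𝔽 F}
    (hf : f.coeff 0 = 0) (hz : motive 0) (ha : ∀ f g, motive f → motive g → motive (f + g))
    (hm : ∀ n a, motive (monomial 𝔽 (n + 1) a)) : motive f := by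
  suffices h : ∀ f : TwistedPolynomial 𝔽 F, motive (f + monomial 𝔽 0 (-f.coeff 0)) by
    have := h f
    have hz' : monomial 𝔽 0 (0 : F) = 0 := SkewPolynomial.monomial_zero_right 0
    rwa [hf, neg_zero, hz', add_zero] at this
  intro f
  have hadd : ∀ a b : F, monomial 𝔽 0 (a + b) = monomial 𝔽 0 a + monomial 𝔽 0 b :=
    SkewPolynomial.monomial_add 0
  have hz' : monomial 𝔽 0 (0 : F) = 0 := SkewPolynomial.monomial_zero_right 0
  induction f using TwistedPolynomial.induction with
  | hz => rwa [coeff_zero, neg_zero, hz', add_zero]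
  | ha f g h₁ h₂ =>
    rw [coeff_add, neg_add, hadd, add_add_add_comm]
    exact ha _ _ h₁ h₂
  | hm n a =>
    cases n with
    | zero => rwa [coeff_monomial, if_pos rfl, ← hadd, add_neg_cancel, hz']
    | succ n =>
      rw [coeff_monomial, if_neg (by omega), neg_zero, hz', add_zero]
      exact hm n a

theorem iterate_frobenius (n : ℕ) (a : F) :
    (FiniteField.frobeniusAlgHom 𝔽 F)^[n] a = a ^ Fintype.card 𝔽 ^ n := by
  rw [FiniteField.coe_frobeniusAlgHom, pow_iterate]

theorem monomial_mul_monomial (n m : ℕ) (a b : F) :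
    monomial 𝔽 n a * monomial 𝔽 m b = monomial 𝔽 (n + m) (a * b ^ Fintype.card 𝔽 ^ n) := by
  rw [← iterate_frobenius]
  let : MulSemiringAction (Multiplicative ℕ) F := frobeniusAction 𝔽 F
  exact SkewPolynomial.monomial_mul_monomial n m a b

theorem smul_monomial (a : F) (n : ℕ) (b : F) :
    a • monomial 𝔽 n b = monomial 𝔽 n (a * b) :=
  SkewPolynomial.smul_monomial n a b

theorem one_def : (1 : TwistedPolynomial 𝔽 F) = monomial 𝔽 0 1 := rfl

theorem monomial_add (n : ℕ) (a b : F) :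
    monomial 𝔽 n (a + b) = monomial 𝔽 n a + monomial 𝔽 n b :=
  SkewPolynomial.monomial_add n a b

theorem monomial_zero_right (n : ℕ) : monomial 𝔽 n (0 : F) = 0 :=
  SkewPolynomial.monomial_zero_right n

attribute [irreducible] instRing

protected theorem smul_mul_assoc (a : F) (f g : TwistedPolynomial 𝔽 F) :
    (a • f) * g = a • (f * g) := by
  induction f using TwistedPolynomial.induction with
  | hz => simp
  | ha f₁ f₂ h₁ h₂ => rw [smul_add, add_mul, h₁, h₂, add_mul, smul_add]
  | hm n b =>
    induction g using TwistedPolynomial.induction with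
    | hz => simp
    | ha g₁ g₂ h₁ h₂ => rw [mul_add, h₁, h₂, mul_add, smul_add]
    | hm m c => simp only [smul_monomial, monomial_mul_monomial, mul_assoc]

instance instIsScalarTower : IsScalarTower F (TwistedPolynomial 𝔽 F) (TwistedPolynomial 𝔽 F) :=
  ⟨TwistedPolynomial.smul_mul_assoc⟩

variable (𝔽 F) in
/-- The inclusion of `F` in `F{τ}` as constant twisted polynomials. -/
def const : F →+* TwistedPolynomial 𝔽 F where
  toFun := monomial 𝔽 0
  map_one' := one_def.symm
  map_mul' a b := by simp [monomial_mul_monomial]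
  map_zero' := monomial_zero_right 0
  map_add' := monomial_add 0

theorem const_apply (a : F) : const 𝔽 F a = monomial 𝔽 0 a := rfl

theorem const_mul (a : F) (f : TwistedPolynomial 𝔽 F) : const 𝔽 F a * f = a • f := by
  have h : const 𝔽 F a = a • (1 : TwistedPolynomial 𝔽 F) := by
    rw [one_def, smul_monomial, mul_one, const_apply]
  rw [h, TwistedPolynomial.smul_mul_assoc, one_mul]

theorem const_commute (c : 𝔽) (f : TwistedPolynomial 𝔽 F) :
    const 𝔽 F (algebraMap 𝔽 F c) * f = f * const 𝔽 F (algebraMap 𝔽 F c) := by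
  induction f using TwistedPolynomial.induction with
  | hz => simp
  | ha f₁ f₂ h₁ h₂ => rw [mul_add, h₁, h₂, add_mul]
  | hm n b =>
    rw [const_apply, monomial_mul_monomial, monomial_mul_monomial, ← map_pow, FiniteField.pow_card_pow]
    simp [mul_comm]

instance instAlgebra : Algebra 𝔽 (TwistedPolynomial 𝔽 F) :=
  ((const 𝔽 F).comp (algebraMap 𝔽 F)).toAlgebra' const_commute

theorem coeff_mul (f g : TwistedPolynomial 𝔽 F) (n : ℕ) :
    (f * g).coeff n =
      ∑ ij ∈ Finset.HasAntidiagonal.antidiagonal n, f.coeff ij.1 * g.coeff ij.2 ^ Fintype.card 𝔽 ^ ij.1 := by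
  have hadd : ∀ (i : ℕ) (a b : F),
      (a + b) ^ Fintype.card 𝔽 ^ i = a ^ Fintype.card 𝔽 ^ i + b ^ Fintype.card 𝔽 ^ i := by
    intro i a b
    simp only [← iterate_frobenius]
    exact iterate_map_add _ i a b
  have hz : ∀ i : ℕ, (0 : F) ^ Fintype.card 𝔽 ^ i = 0 := fun i =>
    zero_pow (pow_ne_zero _ Fintype.card_ne_zero)
  induction f using TwistedPolynomial.induction with
  | hz => simp
  | ha f₁ f₂ h₁ h₂ => simp only [add_mul, coeff_add, h₁, h₂, Finset.sum_add_distrib]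
  | hm k b =>
    induction g using TwistedPolynomial.induction with
    | hz => simp [hz]
    | ha g₁ g₂ h₁ h₂ =>
      simp only [mul_add, coeff_add, h₁, h₂, Finset.sum_add_distrib, hadd]
    | hm m c =>
      rw [monomial_mul_monomial, coeff_monomial]
      split_ifs with h
      · rw [Finset.sum_eq_single (k, m)]
        · simp [coeff_monomial]
        · rintro ⟨i, j⟩ - hij
          simp only [coeff_monomial]
          by_cases hk : k = i
          · have hm : m ≠ j := fun hm => hij (by rw [hk, hm])
            simp [hm, hz]
          · simp [hk]
        · intro hn
          exact absurd (Finset.HasAntidiagonal.mem_antidiagonal.2 h) hn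
      · symm
        apply Finset.sum_eq_zero
        rintro ⟨i, j⟩ hij
        rw [Finset.HasAntidiagonal.mem_antidiagonal] at hij
        simp only [coeff_monomial]
        by_cases hk : k = i
        · have hm : m ≠ j := fun hm => h (by rw [hk, hm]; exact hij)
          simp [hm, hz]
        · simp [hk]

/-- `f` has degree exactly `n` as a polynomial in `τ`. -/
def HasDegree (f : TwistedPolynomial 𝔽 F) (n : ℕ) : Prop :=
  f.coeff n ≠ 0 ∧ ∀ m, n < m → f.coeff m = 0

theorem exists_bound (f : TwistedPolynomial 𝔽 F) : ∃ N, ∀ m, N ≤ m → f.coeff m = 0 := by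
  induction f using TwistedPolynomial.induction with
  | hz => exact ⟨0, fun m _ => coeff_zero m⟩
  | ha f g hf hg =>
    obtain ⟨N, hN⟩ := hf
    obtain ⟨N', hN'⟩ := hg
    exact ⟨max N N', fun m hm => by
      rw [coeff_add, hN m (le_of_max_le_left hm), hN' m (le_of_max_le_right hm), add_zero]⟩
  | hm n a => exact ⟨n + 1, fun m hm => by rw [coeff_monomial, if_neg (by omega)]⟩

theorem exists_hasDegree {f : TwistedPolynomial 𝔽 F} (hf : f ≠ 0) : ∃ n, f.HasDegree n := by
  classical
  obtain ⟨N, hN⟩ := f.exists_bound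
  have hne : ∃ n, f.coeff n ≠ 0 := by
    by_contra! h
    exact hf (ext fun n => by rw [h, coeff_zero])
  obtain ⟨n, hn⟩ := hne
  have hb : ∀ m, f.coeff m ≠ 0 → m ≤ N := fun m hm => by
    by_contra! h
    exact hm (hN m h.le)
  refine ⟨Nat.findGreatest (fun m => f.coeff m ≠ 0) N,
    Nat.findGreatest_spec (P := fun m => f.coeff m ≠ 0) (hb n hn) hn, fun m hm => ?_⟩
  by_contra h
  exact absurd (Nat.le_findGreatest (P := fun m => f.coeff m ≠ 0) (hb m h) h) (by omega)

theorem HasDegree.mul {f g : TwistedPolynomial 𝔽 F} {n m : ℕ} (hf : f.HasDegree n)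
    (hg : g.HasDegree m) : (f * g).HasDegree (n + m) := by
  have hq : ∀ i : ℕ, Fintype.card 𝔽 ^ i ≠ 0 := fun i => pow_ne_zero _ Fintype.card_ne_zero
  constructor
  · rw [coeff_mul, Finset.sum_eq_single (n, m)]
    · exact mul_ne_zero hf.1 (pow_ne_zero _ hg.1)
    · rintro ⟨i, j⟩ hij hne
      rw [Finset.HasAntidiagonal.mem_antidiagonal] at hij
      dsimp only at hij ⊢
      rcases lt_trichotomy i n with h | h | h
      · rw [hg.2 j (by omega), zero_pow (hq i), mul_zero]
      · exact absurd (by rw [h, show j = m by omega]) hne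
      · rw [hf.2 i h, zero_mul]
    · intro h
      exact absurd (by simp) h
  · intro k hk
    rw [coeff_mul]
    apply Finset.sum_eq_zero
    rintro ⟨i, j⟩ hij
    rw [Finset.HasAntidiagonal.mem_antidiagonal] at hij
    dsimp only at hij ⊢
    rcases le_or_gt i n with h | h
    · rw [hg.2 j (by omega), zero_pow (hq i), mul_zero]
    · rw [hf.2 i h, zero_mul]

theorem HasDegree.smul {f : TwistedPolynomial 𝔽 F} {n : ℕ} (hf : f.HasDegree n) {a : F}
    (ha : a ≠ 0) : (a • f).HasDegree n :=
  ⟨by rw [coeff_smul]; exact mul_ne_zero ha hf.1,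
    fun m hm => by rw [coeff_smul, hf.2 m hm, mul_zero]⟩

variable (𝔽 F) in
/-- The twisted polynomial `τ`. -/
def tau : TwistedPolynomial 𝔽 F := monomial 𝔽 1 1

theorem coeff_tau_mul_zero (f : TwistedPolynomial 𝔽 F) : (tau 𝔽 F * f).coeff 0 = 0 := by
  rw [coeff_mul]
  simp [tau, coeff_monomial]

theorem coeff_tau_mul_succ (f : TwistedPolynomial 𝔽 F) (n : ℕ) :
    (tau 𝔽 F * f).coeff (n + 1) = f.coeff n ^ Fintype.card 𝔽 := by
  rw [coeff_mul, Finset.sum_eq_single (1, n)]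
  · simp [tau, coeff_monomial]
  · rintro ⟨i, j⟩ hij hne
    rw [Finset.HasAntidiagonal.mem_antidiagonal] at hij
    dsimp only at hij ⊢
    have h : 1 ≠ i := fun h => hne (by rw [← h, show j = n by omega])
    rw [tau, coeff_monomial, if_neg h, zero_mul]
  · intro h
    exact absurd (Finset.HasAntidiagonal.mem_antidiagonal.2 (add_comm 1 n)) h

theorem tau_mul_smul (a : F) (f : TwistedPolynomial 𝔽 F) :
    tau 𝔽 F * (a • f) = (a ^ Fintype.card 𝔽) • (tau 𝔽 F * f) := by
  ext n
  cases n with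
  | zero => rw [coeff_tau_mul_zero, coeff_smul, coeff_tau_mul_zero, mul_zero]
  | succ n => rw [coeff_tau_mul_succ, coeff_smul, coeff_smul, coeff_tau_mul_succ, mul_pow]

theorem tau_mul_injective : Function.Injective (fun f : TwistedPolynomial 𝔽 F => tau 𝔽 F * f) := by
  intro f g h
  ext n
  have := congrArg (fun u => coeff u (n + 1)) h
  simp only [coeff_tau_mul_succ] at this
  exact (FiniteField.frobeniusAlgHom 𝔽 F).toRingHom.injective this

theorem exists_tau_mul [Finite F] (f : TwistedPolynomial 𝔽 F) (hf : f.coeff 0 = 0) :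
    ∃ g, tau 𝔽 F * g = f := by
  have hs : ∀ a : F, ∃ b : F, b ^ Fintype.card 𝔽 = a :=
    Finite.surjective_of_injective (FiniteField.frobeniusAlgHom 𝔽 F).toRingHom.injective
  refine induction_coeff_zero (motive := fun f => ∃ g, tau 𝔽 F * g = f) hf ⟨0, mul_zero _⟩ ?_ ?_
  · rintro _ _ ⟨f', rfl⟩ ⟨g', rfl⟩
    exact ⟨f' + g', mul_add _ _ _⟩
  · intro n a
    obtain ⟨b, rfl⟩ := hs a
    refine ⟨monomial 𝔽 n b, ?_⟩
    rw [tau, monomial_mul_monomial, one_mul, pow_one, add_comm]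

end TwistedPolynomial
end Twisted

/-! ### Drinfeld modules and Anderson motives -/

section Motive

variable {𝔽 F : Type*} [Field 𝔽] [Fintype 𝔽] [Field F] [Algebra 𝔽 F]

variable (𝔽 F) in
/-- The endomorphism `τ` of `A_F = A ⊗ F = F[t]`: the identity on `A = 𝔽[t]` and the `q`-power
Frobenius on `F`. -/
def frobeniusPoly : F[X] →+* F[X] :=
  Polynomial.mapRingHom (FiniteField.frobeniusAlgHom 𝔽 F : F →+* F)

theorem frobeniusPoly_bijective [Finite F] : Function.Bijective (frobeniusPoly 𝔽 F) := by
  have hi : Function.Injective (FiniteField.frobeniusAlgHom 𝔽 F : F →+* F) := RingHom.injective _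
  exact ⟨Polynomial.map_injective _ hi,
    Polynomial.map_surjective _ (Finite.surjective_of_injective hi)⟩

/-- The element `t - θ` of `A_F = F[t]`, where `θ = γ t`. -/
def tSubTheta (γ : 𝔽[X] →ₐ[𝔽] F) : F[X] := X - C (γ X)

/-- The ring `A_F[1 / (t - θ)]`. -/
abbrev AwayTheta (γ : 𝔽[X] →ₐ[𝔽] F) : Type _ := Localization.Away (tSubTheta γ)

/-- The structure of an Anderson motive over the `A`-field `F` (with structural map `γ : A → F`,
`A = 𝔽[t]`) on an `A_F`-module `M`, with `A_F = F[t]`: the module `M` is finite free, and it is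
given an isomorphism `(τ^* M)[1 / (t - θ)] ≃ M[1 / (t - θ)]`, where `τ^* M = A_F ⊗_{τ, A_F} M`. -/
structure AndersonMotive (γ : 𝔽[X] →ₐ[𝔽] F) (M : Type*) [AddCommGroup M] [Module F[X] M] where
  free : Module.Free F[X] M
  finite : Module.Finite F[X] M
  frob : (AwayTheta γ ⊗[F[X]] Pullback (frobeniusPoly 𝔽 F) M) ≃ₗ[AwayTheta γ]
    (AwayTheta γ ⊗[F[X]] M)

/-- The dual Anderson motive `M^∨ = Hom_{A_F}(M, A_F)`: with the canonical identifications
`(τ^* M^∨)[1 / (t - θ)] = Hom((τ^* M)[1 / (t - θ)], A_F[1 / (t - θ)])` and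
`M^∨[1 / (t - θ)] = Hom(M[1 / (t - θ)], A_F[1 / (t - θ)])`, the map `τ_{M^∨}` is `f ↦ f ∘ τ_M⁻¹`. -/
def AndersonMotive.dual {γ : 𝔽[X] →ₐ[𝔽] F} {M : Type*} [AddCommGroup M] [Module F[X] M]
    (m : AndersonMotive γ M) : AndersonMotive γ (Module.Dual F[X] M) :=
  haveI := m.free
  haveI := m.finite
  { free := inferInstance
    finite := inferInstance
    frob :=
      ((Pullback.dualEquiv (frobeniusPoly 𝔽 F) M).baseChange F[X] (AwayTheta γ) _ _) ≪≫ₗ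
      (TensorProduct.isBaseChange F[X] (Pullback (frobeniusPoly 𝔽 F) M)
        (AwayTheta γ)).toDualBaseChange ≪≫ₗ
      m.frob.symm.dualMap ≪≫ₗ
      (TensorProduct.isBaseChange F[X] M (AwayTheta γ)).toDualBaseChange.symm }

/-- A Drinfeld module over the `A`-field `F` (with structural map `γ : A → F`, `A = 𝔽[t]`): an
`𝔽`-algebra homomorphism `φ : A → F{τ}` such that `φ_t` has constant term `γ t` and positive
degree `rank`. -/
structure DrinfeldModule (γ : 𝔽[X] →ₐ[𝔽] F) where
  toAlgHom : 𝔽[X] →ₐ[𝔽] TwistedPolynomial 𝔽 F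
  rank : ℕ
  rank_pos : 0 < rank
  coeff_zero : (toAlgHom X).coeff 0 = γ X
  hasDegree : (toAlgHom X).HasDegree rank

namespace DrinfeldModule

open TwistedPolynomial

variable {γ : 𝔽[X] →ₐ[𝔽] F} (φ : DrinfeldModule γ)

/-- Right multiplication by `φ_t` on `F{τ}`. -/
def rightMul : TwistedPolynomial 𝔽 F →ₗ[F] TwistedPolynomial 𝔽 F :=
  LinearMap.mulRight F (φ.toAlgHom X)

/-- The `A_F`-module `M(φ)`: the `F`-vector space `F{τ}` on which `t` acts by right multiplication
by `φ_t`; thus `(a ⊗ x) • f = x f φ_a`. -/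
abbrev MotiveModule : Type _ := Module.AEval' φ.rightMul

/-- The identity map `F{τ} → M(φ)`. -/
abbrev of : TwistedPolynomial 𝔽 F ≃ₗ[F] φ.MotiveModule := Module.AEval'.of φ.rightMul

theorem X_smul_of (f : TwistedPolynomial 𝔽 F) :
    (X : F[X]) • φ.of f = φ.of (f * φ.toAlgHom X) :=
  Module.AEval'.X_smul_of φ.rightMul f

theorem C_smul_of (a : F) (f : TwistedPolynomial 𝔽 F) :
    (C a : F[X]) • φ.of f = φ.of (a • f) := by
  rw [Module.AEval.C_smul, map_smul]

/-- The `A_F`-module structure is the expected one: `(a ⊗ x) • f = x f φ_a`. -/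
theorem smul_of (a : 𝔽[X]) (x : F) (f : TwistedPolynomial 𝔽 F) :
    (a.map (algebraMap 𝔽 F) * C x) • φ.of f = φ.of (x • f * φ.toAlgHom a) := by
  rw [mul_smul, C_smul_of]
  generalize x • f = g
  induction a using Polynomial.induction_on' generalizing g with
  | add a b ha hb => rw [Polynomial.map_add, add_smul, ha, hb, map_add, mul_add, map_add]
  | monomial n c =>
    induction n generalizing g with
    | zero =>
      rw [Polynomial.map_monomial, monomial_zero_left, monomial_zero_left, C_smul_of,
        ← Polynomial.algebraMap_eq, AlgHom.commutes, ← const_mul]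
      exact congrArg φ.of (const_commute c g)
    | succ n ih =>
      rw [← Polynomial.monomial_mul_X, Polynomial.map_mul, Polynomial.map_X, mul_smul, X_smul_of,
        ih, ← Polynomial.X_mul, map_mul φ.toAlgHom, mul_assoc]

theorem of_mem_span (N : ℕ) (f : TwistedPolynomial 𝔽 F) (hf : ∀ m, N ≤ m → f.coeff m = 0) :
    φ.of f ∈ Submodule.span F[X]
      ((fun i => φ.of (TwistedPolynomial.monomial 𝔽 i 1)) '' Set.Iio φ.rank) := by
  set S := Submodule.span F[X]
      ((fun i => φ.of (TwistedPolynomial.monomial 𝔽 i 1)) '' Set.Iio φ.rank) with hS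
  induction N using Nat.strong_induction_on generalizing f with
  | _ N ih =>
    cases N with
    | zero =>
      have h0 : f = 0 := TwistedPolynomial.ext fun n => by
        rw [hf n (Nat.zero_le n), TwistedPolynomial.coeff_zero]
      rw [h0, map_zero]
      exact S.zero_mem
    | succ N =>
      by_cases hN : f.coeff N = 0
      · refine ih N (Nat.lt_succ_self N) f fun m hm => ?_
        rcases hm.eq_or_lt with rfl | h
        · exact hN
        · exact hf m h
      have key : ∀ g : TwistedPolynomial 𝔽 F, φ.of g ∈ S → g.HasDegree N →
          g.coeff N = f.coeff N → φ.of f ∈ S := by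
        intro g hg hgd hgN
        have h := ih N (Nat.lt_succ_self N) (f + (-1 : F) • g) (fun m hm => by
          rw [TwistedPolynomial.coeff_add, TwistedPolynomial.coeff_smul]
          rcases hm.eq_or_lt with rfl | h
          · rw [hgN]; ring
          · rw [hf m h, hgd.2 m h]; ring)
        have e : φ.of f = φ.of (f + (-1 : F) • g) + φ.of g := by
          rw [← map_add, neg_one_smul, neg_add_cancel_right]
        rw [e]
        exact S.add_mem h hg
      have hmon : ∀ (k : ℕ) (a : F), a ≠ 0 →
          (TwistedPolynomial.monomial 𝔽 k a).HasDegree k := fun k a ha =>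
        ⟨by rwa [TwistedPolynomial.coeff_monomial, if_pos rfl],
          fun m hm => by rw [TwistedPolynomial.coeff_monomial, if_neg (by omega)]⟩
      by_cases hr : N < φ.rank
      · refine key (TwistedPolynomial.monomial 𝔽 N (f.coeff N)) ?_ (hmon N _ hN)
          (by rw [TwistedPolynomial.coeff_monomial, if_pos rfl])
        have e : φ.of (TwistedPolynomial.monomial 𝔽 N (f.coeff N)) =
            (C (f.coeff N) : F[X]) • φ.of (TwistedPolynomial.monomial 𝔽 N 1) := by
          rw [C_smul_of, TwistedPolynomial.smul_monomial, mul_one]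
        rw [e]
        exact S.smul_mem _ (Submodule.subset_span ⟨N, hr, rfl⟩)
      · have hpos := φ.rank_pos
        set h := TwistedPolynomial.monomial 𝔽 (N - φ.rank) (1 : F) with hh
        have hhd : h.HasDegree (N - φ.rank) := hmon _ _ one_ne_zero
        have hp := hhd.mul φ.hasDegree
        rw [Nat.sub_add_cancel (not_lt.1 hr)] at hp
        have hc : f.coeff N / (h * φ.toAlgHom X).coeff N ≠ 0 := div_ne_zero hN hp.1
        refine key ((f.coeff N / (h * φ.toAlgHom X).coeff N) • (h * φ.toAlgHom X)) ?_
          (hp.smul hc) (by rw [TwistedPolynomial.coeff_smul, div_mul_cancel₀ _ hp.1])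
        rw [← C_smul_of, ← X_smul_of]
        exact S.smul_mem _ (S.smul_mem _ (ih (N - φ.rank + 1) (by omega) h
          fun m hm => hhd.2 m (by omega)))

theorem finite_motiveModule : Module.Finite F[X] φ.MotiveModule := by
  rw [Module.finite_def, Submodule.fg_def]
  refine ⟨_, (Set.finite_Iio φ.rank).image
    (fun i => φ.of (TwistedPolynomial.monomial 𝔽 i 1)), ?_⟩
  rw [eq_top_iff]
  intro x _
  obtain ⟨f, rfl⟩ := φ.of.surjective x
  obtain ⟨N, hN⟩ := f.exists_bound
  exact φ.of_mem_span N f hN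

theorem hasDegree_smul (P : F[X]) (hP : P ≠ 0) (f : TwistedPolynomial 𝔽 F) (n : ℕ)
    (hf : f.HasDegree n) :
    (φ.of.symm (P • φ.of f)).HasDegree (n + φ.rank * P.natDegree) := by
  induction hd : P.natDegree generalizing P with
  | zero =>
    obtain ⟨c, rfl⟩ := Polynomial.natDegree_eq_zero.1 hd
    rw [C_smul_of, LinearEquiv.symm_apply_apply]
    exact hf.smul (by rintro rfl; exact hP (map_zero _))
  | succ d ih =>
    have hd' : P.divX.natDegree = d := by rw [Polynomial.natDegree_divX_eq_natDegree_tsub_one, hd]; rfl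
    have hne : P.divX ≠ 0 := fun h => by
      rw [Polynomial.divX_eq_zero_iff] at h
      rw [h, Polynomial.natDegree_C] at hd
      omega
    have h := ih P.divX hne hd'
    set g := φ.of.symm (P.divX • φ.of f) with hg
    have hg' : P.divX • φ.of f = φ.of g := by rw [hg, LinearEquiv.apply_symm_apply]
    have e : φ.of.symm (P • φ.of f) = g * φ.toAlgHom X + P.coeff 0 • f := by
      conv_lhs => rw [← Polynomial.divX_mul_X_add P, add_smul, ← Polynomial.X_mul, mul_smul, hg',
        X_smul_of, C_smul_of, ← map_add, LinearEquiv.symm_apply_apply]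
    rw [e]
    have h2 := h.mul φ.hasDegree
    have hr := φ.rank_pos
    have e2 : n + φ.rank * (d + 1) = n + φ.rank * d + φ.rank := by ring
    rw [e2]
    constructor
    · rw [TwistedPolynomial.coeff_add, TwistedPolynomial.coeff_smul, hf.2 _ (by omega), mul_zero, add_zero]
      exact h2.1
    · intro m hm
      rw [TwistedPolynomial.coeff_add, TwistedPolynomial.coeff_smul, hf.2 _ (by omega), mul_zero, add_zero]
      exact h2.2 m hm

theorem isTorsionFree_motiveModule : Module.IsTorsionFree F[X] φ.MotiveModule := by
  refine ⟨fun P hP => ?_⟩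
  have hP0 : P ≠ 0 := hP.ne_zero
  rw [isSMulRegular_iff_right_eq_zero_of_smul]
  intro x hx
  by_contra hne
  obtain ⟨f, rfl⟩ := φ.of.surjective x
  have hf : f ≠ 0 := by rintro rfl; exact hne (map_zero _)
  obtain ⟨n, hn⟩ := exists_hasDegree hf
  have := φ.hasDegree_smul P hP0 f n hn
  rw [hx, map_zero] at this
  exact this.1 (TwistedPolynomial.coeff_zero _)

theorem free_motiveModule : Module.Free F[X] φ.MotiveModule :=
  haveI := φ.finite_motiveModule
  haveI := φ.isTorsionFree_motiveModule
  Module.free_of_finite_type_torsion_free'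

theorem tau_mul_smul_of (P : F[X]) (f : TwistedPolynomial 𝔽 F) :
    φ.of (tau 𝔽 F * φ.of.symm (P • φ.of f)) =
      frobeniusPoly 𝔽 F P • φ.of (tau 𝔽 F * f) := by
  induction P using Polynomial.induction_on' generalizing f with
  | add P Q hP hQ => rw [add_smul, map_add, mul_add, map_add, hP, hQ, map_add, add_smul]
  | monomial n c =>
    induction n generalizing f with
    | zero =>
      have e : frobeniusPoly 𝔽 F (C c) = C (c ^ Fintype.card 𝔽) := Polynomial.map_C _
      rw [monomial_zero_left, e, C_smul_of, C_smul_of, LinearEquiv.symm_apply_apply, tau_mul_smul]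
    | succ n ih =>
      have e : frobeniusPoly 𝔽 F X = X := Polynomial.map_X _
      rw [← Polynomial.monomial_mul_X, mul_smul, X_smul_of, ih, map_mul (frobeniusPoly 𝔽 F), e, mul_smul, X_smul_of,
        mul_assoc]

/-- Left multiplication by `τ` on `M(φ) = F{τ}`, as a `τ`-semilinear map. -/
def tauMul : φ.MotiveModule →ₛₗ[frobeniusPoly 𝔽 F] φ.MotiveModule where
  toFun x := φ.of (tau 𝔽 F * φ.of.symm x)
  map_add' x y := by rw [map_add, mul_add, map_add]
  map_smul' P x := by
    obtain ⟨f, rfl⟩ := φ.of.surjective x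
    rw [tau_mul_smul_of, LinearEquiv.symm_apply_apply]

theorem tauMul_of (f : TwistedPolynomial 𝔽 F) : φ.tauMul (φ.of f) = φ.of (tau 𝔽 F * f) := by
  change φ.of (tau 𝔽 F * φ.of.symm (φ.of f)) = _
  rw [LinearEquiv.symm_apply_apply]

theorem lift_tauMul_injective [Finite F] : Function.Injective (Pullback.lift φ.tauMul) := by
  have hmk : ∀ z : Pullback (frobeniusPoly 𝔽 F) φ.MotiveModule,
      ∃ x, z = Pullback.mk (frobeniusPoly 𝔽 F) x := by
    intro z
    induction z using Pullback.induction with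
    | hz => exact ⟨0, (map_zero _).symm⟩
    | ht s m =>
      obtain ⟨s', rfl⟩ := (frobeniusPoly_bijective (𝔽 := 𝔽) (F := F)).2 s
      exact ⟨s' • m, (map_smulₛₗ _ s' m).symm⟩
    | ha x y hx hy =>
      obtain ⟨x', rfl⟩ := hx
      obtain ⟨y', rfl⟩ := hy
      exact ⟨x' + y', (map_add _ x' y').symm⟩
  rw [injective_iff_map_eq_zero]
  intro z hz
  obtain ⟨x, rfl⟩ := hmk z
  obtain ⟨f, rfl⟩ := φ.of.surjective x
  rw [Pullback.lift_mk, tauMul_of, LinearEquiv.map_eq_zero_iff] at hz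
  have h0 : f = 0 := tau_mul_injective (by dsimp only; rw [hz, mul_zero])
  rw [h0, map_zero, map_zero]

theorem tSubTheta_smul_mem_range [Finite F] (x : φ.MotiveModule) :
    tSubTheta γ • x ∈ LinearMap.range (Pullback.lift φ.tauMul) := by
  obtain ⟨f, rfl⟩ := φ.of.surjective x
  have e : tSubTheta γ • φ.of f = φ.of (f * φ.toAlgHom X + (-γ X) • f) := by
    rw [tSubTheta, sub_smul, X_smul_of, C_smul_of, map_add, neg_smul, map_neg, sub_eq_add_neg]
  obtain ⟨g, hg⟩ := exists_tau_mul (f * φ.toAlgHom X + (-γ X) • f) (by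
    rw [TwistedPolynomial.coeff_add, TwistedPolynomial.coeff_smul, TwistedPolynomial.coeff_mul]
    simp [φ.coeff_zero]
    ring)
  exact ⟨Pullback.mk _ (φ.of g), by rw [Pullback.lift_mk, tauMul_of, hg, e]⟩

theorem baseChange_lift_tauMul_bijective [Finite F] :
    Function.Bijective ((Pullback.lift φ.tauMul).baseChange (AwayTheta γ)) := by
  constructor
  · exact Module.Flat.lTensor_preserves_injective_linearMap (M := AwayTheta γ) _
      φ.lift_tauMul_injective
  · rw [← LinearMap.range_eq_top, eq_top_iff]
    intro z _
    induction z using TensorProduct.induction_on with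
    | zero => exact Submodule.zero_mem _
    | add x y hx hy => exact Submodule.add_mem _ (hx trivial) (hy trivial)
    | tmul s x =>
      obtain ⟨y, hy⟩ := φ.tSubTheta_smul_mem_range x
      let u := IsLocalization.Away.invSelf (S := AwayTheta γ) (tSubTheta γ)
      refine ⟨(s * u) ⊗ₜ y, ?_⟩
      rw [LinearMap.baseChange_tmul, hy, ← TensorProduct.smul_tmul, Algebra.smul_def,
        mul_left_comm, IsLocalization.Away.mul_invSelf, mul_one]

/-- The Anderson motive `M(φ)` of a Drinfeld module `φ`: the module `F{τ}` with `τ_{M(φ)}` given by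
the left multiplication by `τ`. -/
def motive [Finite F] : AndersonMotive γ φ.MotiveModule where
  free := φ.free_motiveModule
  finite := φ.finite_motiveModule
  frob := LinearEquiv.ofBijective _ φ.baseChange_lift_tauMul_bijective

end DrinfeldModule

end Motive

/-! ### Euler factors -/

section Euler

set_option linter.unusedSectionVars false

/-- The determinant `det (a - b f | S ⊗_R M)`, taken over `S`, where `S` is an `R`-algebra,
`a, b ∈ S` and `f` is an endomorphism of the `R`-module `M`. -/
def detSub {R S M : Type*} [CommRing R] [CommRing S] [Algebra R S] [AddCommGroup M] [Module R M]
    (a b : S) (f : M →ₗ[R] M) : S :=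
  LinearMap.det (a • (LinearMap.id : S ⊗[R] M →ₗ[S] S ⊗[R] M) - b • f.baseChange S)

/-- The `d`-th iterate of a `σ`-semilinear endomorphism, as a linear map when `σ ^ d = id`. -/
def iterateSemilinear {R M : Type*} [CommRing R] [AddCommGroup M] [Module R M] {σ : R →+* R}
    (g : M →ₛₗ[σ] M) (d : ℕ) (h : ∀ r, σ^[d] r = r) : M →ₗ[R] M where
  toFun := g^[d]
  map_add' x y := iterate_map_add g d x y
  map_smul' r x := by
    have key : ∀ k, g^[k] (r • x) = σ^[k] r • g^[k] x := by
      intro k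
      induction k with
      | zero => rfl
      | succ k ih => rw [Function.iterate_succ_apply', ih, map_smulₛₗ,
          Function.iterate_succ_apply', Function.iterate_succ_apply']
    rw [key d, h, RingHom.id_apply]

variable {𝔽 F : Type*} [Field 𝔽] [Fintype 𝔽] [Field F] [Algebra 𝔽 F]

theorem frobeniusPoly_iterate [Finite F] {d : ℕ} (hd : d = Module.finrank 𝔽 F) (P : F[X]) :
    (frobeniusPoly 𝔽 F)^[d] P = P := by
  have : Fintype F := Fintype.ofFinite F
  ext n
  have key : ∀ k, ((frobeniusPoly 𝔽 F)^[k] P).coeff n = (P.coeff n) ^ Fintype.card 𝔽 ^ k := by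
    intro k
    induction k with
    | zero => simp
    | succ k ih =>
      rw [Function.iterate_succ_apply', frobeniusPoly, Polynomial.coe_mapRingHom,
        Polynomial.coeff_map, ← Polynomial.coe_mapRingHom]
      change ((frobeniusPoly 𝔽 F)^[k] P).coeff n ^ Fintype.card 𝔽 = _
      rw [ih, ← pow_mul, ← pow_succ]
  rw [key, hd, ← Module.card_eq_pow_finrank, FiniteField.pow_card]

variable (F) in
/-- The ring `A[1 / p] ⊗ F = A_F[1 / p]`, where `A = 𝔽[t]`, `A_F = F[t]` and `p ∈ A`. -/
abbrev AwayPrime (p : 𝔽[X]) : Type _ := Localization.Away (p.map (algebraMap 𝔽 F))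

theorem frobeniusPoly_map (p : 𝔽[X]) :
    frobeniusPoly 𝔽 F (p.map (algebraMap 𝔽 F)) = p.map (algebraMap 𝔽 F) := by
  rw [frobeniusPoly, Polynomial.coe_mapRingHom, Polynomial.map_map]
  congr 1
  exact (FiniteField.frobeniusAlgHom 𝔽 F).comp_algebraMap

variable (F) in
/-- The endomorphism `τ` of `A[1 / p] ⊗ F`: the identity on `A[1 / p]` and the `q`-power Frobenius
on `F`. -/
def frobeniusAway (p : 𝔽[X]) : AwayPrime F p →+* AwayPrime F p :=
  IsLocalization.Away.lift (p.map (algebraMap 𝔽 F))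
    (g := (algebraMap F[X] (AwayPrime F p)).comp (frobeniusPoly 𝔽 F)) (by
      rw [RingHom.comp_apply, frobeniusPoly_map]
      exact IsLocalization.Away.algebraMap_isUnit _)

theorem frobeniusAway_algebraMap (p : 𝔽[X]) (P : F[X]) :
    frobeniusAway F p (algebraMap F[X] (AwayPrime F p) P) =
      algebraMap F[X] (AwayPrime F p) (frobeniusPoly 𝔽 F P) :=
  IsLocalization.Away.lift_eq _ _ P

theorem frobeniusAway_iterate [Finite F] (p : 𝔽[X]) {d : ℕ} (hd : d = Module.finrank 𝔽 F)
    (x : AwayPrime F p) : (frobeniusAway F p)^[d] x = x := by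
  have key : ∀ k P, (frobeniusAway F p)^[k] (algebraMap F[X] (AwayPrime F p) P) =
      algebraMap F[X] (AwayPrime F p) ((frobeniusPoly 𝔽 F)^[k] P) := by
    intro k P
    induction k with
    | zero => rfl
    | succ k ih => rw [Function.iterate_succ_apply', ih, frobeniusAway_algebraMap,
        Function.iterate_succ_apply']
  have h : (frobeniusAway F p) ^ d = RingHom.id (AwayPrime F p) := by
    apply IsLocalization.ringHom_ext (Submonoid.powers (p.map (algebraMap 𝔽 F)))
    refine RingHom.ext fun P => ?_
    rw [RingHom.comp_apply, RingHom.coe_pow, key, frobeniusPoly_iterate hd]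
    rfl
  rw [← RingHom.coe_pow, h, RingHom.id_apply]

variable {γ : 𝔽[X] →ₐ[𝔽] F} {p : 𝔽[X]}

theorem tSubTheta_dvd (hker : RingHom.ker γ = Ideal.span {p}) :
    tSubTheta γ ∣ p.map (algebraMap 𝔽 F) := by
  have h0 : γ p = 0 := by
    rw [← RingHom.mem_ker, hker]
    exact Ideal.mem_span_singleton_self p
  have e : γ = Polynomial.aeval (γ X) := by ext; simp
  rw [tSubTheta, Polynomial.dvd_iff_isRoot, Polynomial.IsRoot, Polynomial.eval_map_algebraMap, ← e, h0]

/-- The canonical map `A_F[1 / (t - θ)] → A_F[1 / p]`, where `p` generates the kernel of `γ`; it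
exists because `t - θ` divides `p` in `A_F`. -/
def awayThetaToPrime (hker : RingHom.ker γ = Ideal.span {p}) :
    AwayTheta γ →ₐ[F[X]] AwayPrime F p :=
  IsLocalization.Away.liftAlgHom (tSubTheta γ) (f := Algebra.ofId F[X] (AwayPrime F p))
    (isUnit_of_dvd_unit (map_dvd _ (tSubTheta_dvd hker))
      (IsLocalization.Away.algebraMap_isUnit (p.map (algebraMap 𝔽 F))))

namespace AndersonMotive

variable {M : Type*} [AddCommGroup M] [Module F[X] M] (m : AndersonMotive γ M)

/-- The map `M → A[1 / p] ⊗_A M` induced by `τ_M`. -/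
def frobRestrict (hker : RingHom.ker γ = Ideal.span {p}) : M →+ AwayPrime F p ⊗[F[X]] M where
  toFun x := (awayThetaToPrime hker).toLinearMap.rTensor M
    (m.frob (1 ⊗ₜ[F[X]] Pullback.mk (frobeniusPoly 𝔽 F) x))
  map_zero' := by rw [map_zero, TensorProduct.tmul_zero, map_zero, map_zero]
  map_add' x y := by rw [map_add, TensorProduct.tmul_add, map_add, map_add]

theorem frobRestrict_smul (hker : RingHom.ker γ = Ideal.span {p}) (r : F[X]) (x : M) :
    m.frobRestrict hker (r • x) =
      frobeniusAway F p (algebraMap F[X] (AwayPrime F p) r) • m.frobRestrict hker x := by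
  rw [frobeniusAway_algebraMap, algebraMap_smul]
  change (awayThetaToPrime hker).toLinearMap.rTensor M
    (m.frob (1 ⊗ₜ[F[X]] Pullback.mk (frobeniusPoly 𝔽 F) (r • x))) = _ •
      (awayThetaToPrime hker).toLinearMap.rTensor M
        (m.frob (1 ⊗ₜ[F[X]] Pullback.mk (frobeniusPoly 𝔽 F) x))
  rw [map_smulₛₗ, TensorProduct.tmul_smul, ← map_smul]
  congr 1
  rw [← algebraMap_smul (AwayTheta γ), map_smul, algebraMap_smul]

/-- The `τ`-semilinear endomorphism `τ_M` of `A[1 / p] ⊗_A M`. -/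
def frobAway (hker : RingHom.ker γ = Ideal.span {p}) :
    AwayPrime F p ⊗[F[X]] M →ₛₗ[frobeniusAway F p] AwayPrime F p ⊗[F[X]] M :=
  extendSemilinear (frobeniusAway F p) (m.frobRestrict hker) (m.frobRestrict_smul hker)

/-- The Euler factor `P(M; T) = det (1 - T ^ d τ_M ^ d | A[1 / p, T] ⊗_A M)`, the determinant being
taken over `A[1 / p, T] ⊗ F`. Here `F` is finite, `p` is a generator of `ker γ` and
`d = deg p = [F : 𝔽]`. -/
def eulerFactor [Finite F] (hker : RingHom.ker γ = Ideal.span {p})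
    (hdeg : p.natDegree = Module.finrank 𝔽 F) : (AwayPrime F p)[X] :=
  detSub 1 (X ^ p.natDegree) (iterateSemilinear (m.frobAway hker) p.natDegree
    (frobeniusAway_iterate p hdeg))

end AndersonMotive

/-! ### Fitting ideals and the `T`-twisted module -/

/-- The (zeroth) Fitting ideal of an `R`-module `M`: the ideal generated by the determinants of all
the square matrices whose rows are relations between the members of a finite generating family. -/
def fittingIdeal (R M : Type*) [CommRing R] [AddCommGroup M] [Module R M] : Ideal R :=
  Ideal.span {a : R | ∃ (n : ℕ) (x : Fin n → M) (N : Matrix (Fin n) (Fin n) R),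
    Submodule.span R (Set.range x) = ⊤ ∧ (∀ i, ∑ j, N i j • x j = 0) ∧ a = N.det}

/-- For an `A_F`-algebra `S`, with `A = 𝔽[t]` and `A_F = F[t]`, the canonical map `A[T] → S[T]`.
The ring `A[T]` is written as `𝔽[T][t]`: the inner variable is `T` and the outer one is `t`. -/
def coeffMap (𝔽 F : Type*) [Field 𝔽] [Field F] [Algebra 𝔽 F] (S : Type*) [CommRing S]
    [Algebra F[X] S] : 𝔽[X][X] →+* S[X] :=
  Polynomial.eval₂RingHom
    (Polynomial.mapRingHom ((algebraMap F[X] S).comp (C.comp (algebraMap 𝔽 F))))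
    (C (algebraMap F[X] S X))

namespace DrinfeldModule

variable (φ : DrinfeldModule γ)

/-- The action on `F[T] = 𝔽[T] ⊗ F` of `φ^∼_t = γ(t) + g_1 T τ + ⋯ + g_r T ^ r τ ^ r`, where
`φ_t = γ(t) + g_1 τ + ⋯ + g_r τ ^ r`; the endomorphism `τ` acts on `F` by the `q`-power Frobenius
and commutes with `T`. -/
def twistedEnd : 𝔽[X] ⊗[𝔽] F →ₗ[𝔽[X]] 𝔽[X] ⊗[𝔽] F :=
  ∑ i ∈ Finset.range (φ.rank + 1), (X ^ i : 𝔽[X]) •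
    (LinearMap.mulLeft 𝔽 ((φ.toAlgHom X).coeff i) ∘ₗ
      (FiniteField.frobeniusAlgHom 𝔽 F ^ i).toLinearMap).baseChange 𝔽[X]

/-- The `T`-twisted module `φ^∼(F)`: the `A[T]`-module `F[T]` on which `t` acts through `φ^∼_t`.
The ring `A[T]` is written as `𝔽[T][t]`. -/
abbrev TwistedModule : Type _ := Module.AEval' φ.twistedEnd

/-- The element `det (t - φ^∼_t | A ⊗ F[T])` of `A[T] = 𝔽[T][t]`, the determinant being taken over
`A[T]`. -/
def twistedDet : 𝔽[X][X] :=
  detSub X 1 φ.twistedEnd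

/-- The polynomial `det (T ^ d - τ ^ d | M(φ)[T])` of `A_F[T]`, where `τ ^ d` is the `d`-th iterate
of `τ_{M(φ)}` and `d = [F : 𝔽]`: this is the characteristic polynomial of the Frobenius of `φ`,
evaluated at `T ^ d`. -/
def frobeniusCharpoly [Finite F] : F[X][X] :=
  detSub (X ^ Module.finrank 𝔽 F) 1 (iterateSemilinear φ.tauMul (Module.finrank 𝔽 F)
    (frobeniusPoly_iterate rfl))

end DrinfeldModule

end Euler

end Drinfeld

end

noncomputable section

namespace Drinfeld

/-! ### Fitting ideals of modules with a square presentation -/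

section Fitting

variable {R M : Type*} [CommRing R] [AddCommGroup M] [Module R M]

/-! The whole theorem comes from one object, `F{τ}`, and two commuting actions on it: `t` by right
multiplication by `φ_t`, and `s` by left multiplication by `τ ^ d`. The second action is `F`-linear
because `x ^ (q ^ d) = x` on `F`. Thus `F{τ}` is a module over `F[s, t]`.

Over `F[t]` it is the finite free module `M(φ)`, with `s` acting as the Frobenius; over `F[s]` it is
free on `1, τ, …, τ ^ (d - 1)`, with `t` acting as an endomorphism. For an endomorphism of a finite
free module the Fitting ideal is generated by the characteristic polynomial (`fittingIdeal_AEval'`),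
so computing the Fitting ideal over `F[s, t]` both ways shows that the two characteristic
polynomials agree up to a unit (`associated_charpoly_frobenius`).

It remains to recognise the second one. Row `i` of the matrix of `φ_t` over `F[s]` comes from `τ ^ i
φ_t = ∑ g_j ^ (q ^ i) τ ^ (i + j)`. After `s = T ^ d`, the map `x ↦ (x ^ (q ^ i) T ^ i)_i`
intertwines this matrix with `φ^∼_t` on `F[T]`. The determinant of the map is a power of `T` times a
Moore determinant, hence nonzero, so the characteristic polynomials coincide
(`map_charpoly_twistedEnd`). Statements 1 and 3 follow.

For statement 2, `τ ^ d` on the dual motive is the contragredient of `τ ^ d` on `M(φ)`, so `det (1 -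
T ^ d τ ^ d)` on the dual is `det (T ^ d - τ ^ d)` on `M(φ)` up to a factor free of `T`
(`det_neg_mul_detSub`). By statement 3 it is proportional to the twisted determinant, and `T = 0`
gives the constant: the Euler factor becomes `1`, while the twisted determinant becomes the
characteristic polynomial of `γ t` acting on `F`, which is `p`. -/

theorem exists_matrix_of_span_eq_top {ι κ : Type*} [Fintype ι] {y : ι → M}
    (hy : Submodule.span R (Set.range y) = ⊤) (x : κ → M) :
    ∃ U : Matrix κ ι R, ∀ i, x i = ∑ j, U i j • y j := by
  have h : ∀ i, ∃ c : ι → R, ∑ j, c j • y j = x i := fun i =>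
    (Submodule.mem_span_range_iff_exists_fun R).1 (hy ▸ Submodule.mem_top)
  choose U hU using h
  exact ⟨U, fun i => (hU i).symm⟩

theorem sum_mul_smul {ι κ l : Type*} [Fintype ι] [Fintype κ] (N : Matrix l κ R)
    (U : Matrix κ ι R) (y : ι → M) (i : l) :
    ∑ j, (N * U) i j • y j = ∑ k, N i k • ∑ j, U k j • y j := by
  simp only [Matrix.mul_apply, Finset.sum_smul, Finset.smul_sum, mul_smul]
  exact Finset.sum_comm

theorem exists_mul_eq_of_relations {ι l : Type*} [Fintype ι] {y : ι → M} {P : Matrix ι ι R}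
    (hrel : ∀ c : ι → R, ∑ j, c j • y j = 0 → ∃ w : ι → R, Matrix.vecMul w P = c)
    (L : Matrix l ι R) (hL : ∀ i, ∑ j, L i j • y j = 0) : ∃ Q : Matrix l ι R, Q * P = L := by
  choose Q hQ using fun i => hrel (L i) (hL i)
  exact ⟨Matrix.of Q, Matrix.ext fun i k => congrFun (hQ i) k⟩

/-- The determinant of a square matrix of relations between generators is divisible by the
determinant of any square presentation matrix. -/
theorem det_dvd_det_of_relations {ι κ : Type*} [Fintype ι] [DecidableEq ι] [Fintype κ]
    [DecidableEq κ] {y : ι → M} {P : Matrix ι ι R} (hy : Submodule.span R (Set.range y) = ⊤)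
    (hrel : ∀ c : ι → R, ∑ j, c j • y j = 0 → ∃ w : ι → R, Matrix.vecMul w P = c)
    {x : κ → M} {N : Matrix κ κ R} (hx : Submodule.span R (Set.range x) = ⊤)
    (hN : ∀ i, ∑ j, N i j • x j = 0) : P.det ∣ N.det := by
  obtain ⟨U, hU⟩ := exists_matrix_of_span_eq_top hy x
  obtain ⟨V, hV⟩ := exists_matrix_of_span_eq_top hx y
  obtain ⟨Q, hQ⟩ := exists_mul_eq_of_relations hrel (N * U) fun i => by
    rw [sum_mul_smul]
    simp only [← hU]
    exact hN i
  obtain ⟨W, hW⟩ := exists_mul_eq_of_relations hrel (1 - V * U) fun i => by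
    simp only [Matrix.sub_apply, sub_smul, Finset.sum_sub_distrib, sum_mul_smul]
    simp only [← hU]
    rw [← hV]
    simp [Matrix.one_apply]
  -- Both products equal the block matrix with rows `(N, N U)` and `(-V, 1 - V U)`. The left side
  -- has determinant `det N`, the right side a multiple of `det P`; the two generating families may
  -- have different sizes.
  have key : Matrix.fromBlocks N 0 (-V) 1 * Matrix.fromBlocks 1 U 0 1 =
      Matrix.fromBlocks N Q (-V) W * Matrix.fromBlocks 1 0 0 P := by
    simp only [Matrix.fromBlocks_multiply, hQ, hW]
    simp [sub_eq_neg_add]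
  have h := congrArg Matrix.det key
  rw [Matrix.det_mul, Matrix.det_mul, Matrix.det_fromBlocks_zero₁₂, Matrix.det_fromBlocks_zero₂₁,
    Matrix.det_fromBlocks_zero₂₁] at h
  simp only [Matrix.det_one, mul_one, one_mul] at h
  exact ⟨_, h.trans (mul_comm _ _)⟩

theorem fittingIdeal_eq_span_det {ι : Type*} [Fintype ι] [DecidableEq ι] {y : ι → M}
    {P : Matrix ι ι R} (hy : Submodule.span R (Set.range y) = ⊤)
    (hP : ∀ i, ∑ j, P i j • y j = 0)
    (hrel : ∀ c : ι → R, ∑ j, c j • y j = 0 → ∃ w : ι → R, Matrix.vecMul w P = c) :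
    fittingIdeal R M = Ideal.span {P.det} := by
  apply le_antisymm
  · rw [fittingIdeal, Ideal.span_le]
    rintro _ ⟨n, x, N, hx, hN, rfl⟩
    exact Ideal.mem_span_singleton.2 (det_dvd_det_of_relations hy hrel hx hN)
  · rw [Ideal.span_singleton_le_iff_mem]
    let e := Fintype.equivFin ι
    refine Ideal.subset_span ⟨Fintype.card ι, y ∘ e.symm, P.submatrix e.symm e.symm, ?_, ?_, ?_⟩
    · rwa [e.symm.surjective.range_comp]
    · intro i
      rw [← hP (e.symm i)]
      exact e.symm.sum_comp fun j => P (e.symm i) j • y j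
    · rw [Matrix.det_submatrix_equiv_self]

/-- Fitting ideals are compatible with semilinear isomorphisms. -/
theorem fittingIdeal_map_le {S N : Type*} [CommRing S] [AddCommGroup N] [Module S N]
    (e : R ≃+* S) (g : M ≃+ N) (hg : ∀ r m, g (r • m) = e r • g m) :
    (fittingIdeal R M).map (e : R →+* S) ≤ fittingIdeal S N := by
  rw [fittingIdeal, Ideal.map_span, Ideal.span_le]
  rintro _ ⟨_, ⟨n, x, A, hx, hA, rfl⟩, rfl⟩
  refine Ideal.subset_span ⟨n, g ∘ x, A.map e, ?_, fun i => ?_, ?_⟩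
  · rw [eq_top_iff]
    intro z _
    obtain ⟨m, rfl⟩ := g.surjective z
    obtain ⟨c, rfl⟩ := (Submodule.mem_span_range_iff_exists_fun R).1
      (hx ▸ Submodule.mem_top : m ∈ Submodule.span R (Set.range x))
    refine (Submodule.mem_span_range_iff_exists_fun S).2 ⟨fun i => e (c i), ?_⟩
    simp [map_sum, hg]
  · have h := congrArg g (hA i)
    simpa [map_sum, hg] using h
  · exact e.toRingHom.map_det A

theorem fittingIdeal_map_ringEquiv {S N : Type*} [CommRing S] [AddCommGroup N] [Module S N]
    (e : R ≃+* S) (g : M ≃+ N) (hg : ∀ r m, g (r • m) = e r • g m) :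
    (fittingIdeal R M).map (e : R →+* S) = fittingIdeal S N := by
  apply le_antisymm (fittingIdeal_map_le e g hg)
  have h := fittingIdeal_map_le e.symm g.symm fun s z => g.injective (by
    rw [hg, AddEquiv.apply_symm_apply, AddEquiv.apply_symm_apply, RingEquiv.apply_symm_apply])
  have h2 := Ideal.map_mono (f := (e : R →+* S)) h
  rw [Ideal.map_map] at h2
  have e1 : (e : R →+* S).comp (e.symm : S →+* R) = RingHom.id S := by
    ext; simp
  rwa [e1, Ideal.map_id] at h2

end Fitting

/-! ### The Fitting ideal of an endomorphism -/

section Charpoly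

variable {R V : Type*} [CommRing R] [AddCommGroup V] [Module R V]

/-- Every vector of polynomials is constant modulo the columns of the characteristic matrix. -/
theorem exists_vecMul_charmatrix_add {ι : Type*} [Fintype ι] [DecidableEq ι] (A : Matrix ι ι R)
    (c : ι → R[X]) : ∃ (w : ι → R[X]) (c₀ : ι → R),
      c = Matrix.vecMul w A.charmatrix.transpose + fun i => C (c₀ i) := by
  have hadd : ∀ c c' : ι → R[X],
      (∃ (w : ι → R[X]) (c₀ : ι → R),
        c = Matrix.vecMul w A.charmatrix.transpose + fun i => C (c₀ i)) →
      (∃ (w : ι → R[X]) (c₀ : ι → R),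
        c' = Matrix.vecMul w A.charmatrix.transpose + fun i => C (c₀ i)) →
      ∃ (w : ι → R[X]) (c₀ : ι → R),
        c + c' = Matrix.vecMul w A.charmatrix.transpose + fun i => C (c₀ i) := by
    rintro _ _ ⟨w, c₀, rfl⟩ ⟨w', c₀', rfl⟩
    refine ⟨w + w', c₀ + c₀', ?_⟩
    rw [Matrix.add_vecMul, add_add_add_comm]
    congr 1
    funext i
    simp
  -- This is `X = (X - A) + A` applied to a constant vector: modulo the columns of `X - A`,
  -- multiplication by `X` is `A`, which keeps vectors constant.
  have hX : ∀ c₀ : ι → R, (X : R[X]) • (fun i => C (c₀ i)) =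
      Matrix.vecMul (fun i => C (c₀ i)) A.charmatrix.transpose +
        fun i => C (Matrix.mulVec A c₀ i) := by
    intro c₀
    funext k
    simp only [Matrix.vecMul_transpose, Matrix.charmatrix, Pi.add_apply, Matrix.sub_mulVec,
      Pi.sub_apply, Pi.smul_apply, smul_eq_mul]
    have h1 : Matrix.mulVec (Matrix.scalar ι (X : R[X])) (fun i => C (c₀ i)) k = X * C (c₀ k) := by
      simp [Matrix.mulVec_diagonal]
    rw [h1]
    simp [Matrix.mulVec, dotProduct, map_sum]
  induction c using Pi.single_induction with
  | zero => exact ⟨0, 0, by ext; simp⟩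
  | add c c' h h' => exact hadd c c' h h'
  | single j P =>
    induction P using Polynomial.induction_on' with
    | add P Q hP hQ => rw [Pi.single_add]; exact hadd _ _ hP hQ
    | monomial n a =>
      induction n with
      | zero =>
        refine ⟨0, Pi.single j a, ?_⟩
        rw [Matrix.zero_vecMul, zero_add]
        funext i
        by_cases h : i = j
        · subst h; simp
        · simp [h]
      | succ n ih =>
        obtain ⟨w, c₀, h⟩ := ih
        refine ⟨(X : R[X]) • w + fun i => C (c₀ i), Matrix.mulVec A c₀, ?_⟩
        rw [Matrix.add_vecMul, add_assoc, ← hX, Matrix.smul_vecMul, ← smul_add, ← h,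
          ← Polynomial.monomial_mul_X, mul_comm, ← smul_eq_mul, Pi.single_smul]

/-- The module is the cokernel of `X - f` on `R[X] ⊗ V`, so the characteristic matrix presents it.
Relations are rows here while images are columns of `A`, hence the transpose. These relations are
all of them: modulo them every relation has constant coefficients, and those vanish because `b` is a
basis. -/
theorem fittingIdeal_AEval' [Module.Free R V] [Module.Finite R V] (f : V →ₗ[R] V) :
    fittingIdeal R[X] (Module.AEval' f) = Ideal.span {f.charpoly} := by
  let b := Module.Free.chooseBasis R V
  set A := LinearMap.toMatrix b b f with hA
  have hf : ∀ j, f (b j) = ∑ i, A i j • b i := fun j => by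
    conv_lhs => rw [← b.sum_repr (f (b j))]
    simp [hA, LinearMap.toMatrix_apply]
  let y := fun i => Module.AEval'.of f (b i)
  have hP : ∀ i, ∑ j, A.charmatrix.transpose i j • y j = 0 := fun i => by
    have h1 : ∀ j, A.charmatrix.transpose i j • y j =
        (if j = i then (X : R[X]) • y j else 0) - Module.AEval'.of f (A j i • b j) := fun j => by
      rw [Matrix.transpose_apply, Matrix.charmatrix, Matrix.sub_apply, sub_smul, map_smul]
      congr 1
      · by_cases h : j = i
        · subst h; simp
        · simp [h]
      · simp [y]
    simp only [h1, Finset.sum_sub_distrib, ← map_sum, ← hf]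
    simp [y, Module.AEval'.X_smul_of]
  have hspan : Submodule.span R[X] (Set.range y) = ⊤ := by
    rw [eq_top_iff]
    intro z _
    obtain ⟨v, rfl⟩ := (Module.AEval'.of f).surjective z
    rw [← b.sum_repr v, map_sum]
    refine Submodule.sum_mem _ fun i _ => ?_
    rw [map_smul, ← Module.AEval.C_smul]
    exact Submodule.smul_mem _ _ (Submodule.subset_span ⟨i, rfl⟩)
  rw [fittingIdeal_eq_span_det hspan hP, Matrix.det_transpose, ← Matrix.charpoly, hA,
    LinearMap.charpoly_toMatrix]
  intro c hc
  obtain ⟨w, c₀, rfl⟩ := exists_vecMul_charmatrix_add A c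
  refine ⟨w, ?_⟩
  have h0 : ∑ j, Matrix.vecMul w A.charmatrix.transpose j • y j = 0 := by
    simp only [Matrix.vecMul, dotProduct, Finset.sum_smul, mul_smul]
    rw [Finset.sum_comm]
    simp only [← Finset.smul_sum, hP, smul_zero, Finset.sum_const_zero]
  simp only [Pi.add_apply, add_smul, Finset.sum_add_distrib, h0, zero_add] at hc
  have h1 : Module.AEval'.of f (∑ j, c₀ j • b j) = 0 := by
    rw [← hc, map_sum]
    simp [y]
  rw [LinearEquiv.map_eq_zero_iff] at h1
  have h2 := Fintype.linearIndependent_iff.1 b.linearIndependent c₀ h1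
  funext i
  simp [h2]

/-- `det (a - b f | S ⊗ V)` in coordinates. -/
theorem detSub_eq_det {S ι : Type*} [CommRing S] [Algebra R S] [Fintype ι] [DecidableEq ι]
    (v : Module.Basis ι R V) (a b : S) (f : V →ₗ[R] V) :
    detSub a b f =
      (a • (1 : Matrix ι ι S) - b • (LinearMap.toMatrix v v f).map (algebraMap R S)).det := by
  rw [detSub, ← LinearMap.det_toMatrix (Algebra.TensorProduct.basis S v)]
  congr 1
  refine (map_sub (LinearMap.toMatrix (Algebra.TensorProduct.basis S v) (Algebra.TensorProduct.basis S v)) _ _).trans ?_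
  rw [map_smul, map_smul, LinearMap.toMatrix_id, LinearMap.toMatrix_baseChange]

theorem detSub_one_right {S : Type*} [CommRing S] [Algebra R S] [Module.Free R V]
    [Module.Finite R V] (a : S) (f : V →ₗ[R] V) : detSub a 1 f = aeval a f.charpoly := by
  classical
  let v := Module.Free.chooseBasis R V
  rw [detSub_eq_det v, ← LinearMap.charpoly_toMatrix f v, ← Polynomial.eval_map_algebraMap,
    ← Matrix.charpoly_map, Matrix.eval_charpoly, one_smul]
  simp [Matrix.smul_one_eq_diagonal]

theorem detSub_X_one [Module.Free R V] [Module.Finite R V] (f : V →ₗ[R] V) :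
    detSub (X : R[X]) 1 f = f.charpoly := by
  rw [detSub_one_right, Polynomial.aeval_X_left_apply]

end Charpoly

/-! ### Pairs of commuting endomorphisms -/

section Commuting

variable {R W : Type*} [CommRing R] [AddCommGroup W] [Module R W]

/-- An endomorphism commuting with `s`, as an `R[X]`-linear endomorphism of `AEval' s`. -/
def commutingEnd (s t : W →ₗ[R] W) (h : ∀ w, t (s w) = s (t w)) :
    Module.AEval' s →ₗ[R[X]] Module.AEval' s :=
  LinearMap.ofAEval s ((Module.AEval'.of s).toLinearMap ∘ₗ t) fun w => by
    change Module.AEval'.of s (t (s w)) = X • Module.AEval'.of s (t w)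
    rw [h, Module.AEval'.X_smul_of]

@[simp]
theorem commutingEnd_of (s t : W →ₗ[R] W) (h : ∀ w, t (s w) = s (t w)) (w : W) :
    commutingEnd s t h (Module.AEval'.of s w) = Module.AEval'.of s (t w) :=
  rfl

/-- Exchanging the roles of two commuting endomorphisms exchanges the two variables in the Fitting
ideal. -/
theorem fittingIdeal_commutingEnd_swap (s t : W →ₗ[R] W) (h : ∀ w, t (s w) = s (t w))
    (h' : ∀ w, s (t w) = t (s w)) :
    (fittingIdeal R[X][X] (Module.AEval' (commutingEnd s t h))).map
        ((Bivariate.swap (R := R)).toRingEquiv : R[X][X] →+* R[X][X]) =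
      fittingIdeal R[X][X] (Module.AEval' (commutingEnd t s h')) := by
  let ι₁ : W ≃+ Module.AEval' (commutingEnd s t h) :=
    (Module.AEval'.of s).toAddEquiv.trans (Module.AEval'.of (commutingEnd s t h)).toAddEquiv
  let ι₂ : W ≃+ Module.AEval' (commutingEnd t s h') :=
    (Module.AEval'.of t).toAddEquiv.trans (Module.AEval'.of (commutingEnd t s h')).toAddEquiv
  have a₁ : ∀ (a : R) w, (C (C a) : R[X][X]) • ι₁ w = ι₁ (a • w) := fun a w => by
    change C (C a) • Module.AEval'.of _ (Module.AEval'.of s w) =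
      Module.AEval'.of _ (Module.AEval'.of s (a • w))
    rw [Module.AEval.C_smul, ← map_smul, Module.AEval.C_smul, ← map_smul]
  have a₂ : ∀ (a : R) w, (C (C a) : R[X][X]) • ι₂ w = ι₂ (a • w) := fun a w => by
    change C (C a) • Module.AEval'.of _ (Module.AEval'.of t w) =
      Module.AEval'.of _ (Module.AEval'.of t (a • w))
    rw [Module.AEval.C_smul, ← map_smul, Module.AEval.C_smul, ← map_smul]
  have b₁ : ∀ w, (C X : R[X][X]) • ι₁ w = ι₁ (s w) := fun w => by
    change C X • Module.AEval'.of _ (Module.AEval'.of s w) =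
      Module.AEval'.of _ (Module.AEval'.of s (s w))
    rw [Module.AEval.C_smul, ← map_smul, Module.AEval'.X_smul_of]
  have b₂ : ∀ w, (C X : R[X][X]) • ι₂ w = ι₂ (t w) := fun w => by
    change C X • Module.AEval'.of _ (Module.AEval'.of t w) =
      Module.AEval'.of _ (Module.AEval'.of t (t w))
    rw [Module.AEval.C_smul, ← map_smul, Module.AEval'.X_smul_of]
  have c₁ : ∀ w, (X : R[X][X]) • ι₁ w = ι₁ (t w) := fun w => by
    change X • Module.AEval'.of _ (Module.AEval'.of s w) =
      Module.AEval'.of _ (Module.AEval'.of s (t w))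
    rw [Module.AEval'.X_smul_of, commutingEnd_of]
  have c₂ : ∀ w, (X : R[X][X]) • ι₂ w = ι₂ (s w) := fun w => by
    change X • Module.AEval'.of _ (Module.AEval'.of t w) =
      Module.AEval'.of _ (Module.AEval'.of t (s w))
    rw [Module.AEval'.X_smul_of, commutingEnd_of]
  -- Both modules have `W` as underlying group, and `g` is the identity of `W`. The scalars for
  -- which `g` is semilinear along the swap form a subring, so constants and the two variables
  -- suffice.
  let g := ι₁.symm.trans ι₂
  have hι : ∀ w, g (ι₁ w) = ι₂ w := fun w => congrArg ι₂ (ι₁.symm_apply_apply w)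
  let T : Subring R[X][X] :=
    { carrier := {r | ∀ m, g (r • m) = Bivariate.swap r • g m}
      mul_mem' := fun {r r'} hr hr' m => by rw [mul_smul, hr, hr', map_mul, mul_smul]
      one_mem' := fun m => by rw [one_smul, map_one, one_smul]
      add_mem' := fun {r r'} hr hr' m => by rw [add_smul, map_add, hr, hr', map_add, add_smul]
      zero_mem' := fun m => by rw [zero_smul, map_zero, map_zero, zero_smul]
      neg_mem' := fun {r} hr m => by rw [neg_smul, map_neg, hr, map_neg, neg_smul] }
  have hT₁ : ∀ a : R, C (C a) ∈ T := fun a m => by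
    obtain ⟨w, rfl⟩ := ι₁.surjective m
    rw [a₁, hι, hι, Bivariate.swap_C_C, a₂]
  have hT₂ : C X ∈ T := fun m => by
    obtain ⟨w, rfl⟩ := ι₁.surjective m
    rw [b₁, hι, hι, Bivariate.swap_X, c₂]
  have hT₃ : X ∈ T := fun m => by
    obtain ⟨w, rfl⟩ := ι₁.surjective m
    rw [c₁, hι, hι, Bivariate.swap_Y, b₂]
  have hT₄ : ∀ P : R[X], C P ∈ T := fun P => by
    induction P using Polynomial.induction_on' with
    | add P Q hP hQ => rw [map_add]; exact T.add_mem hP hQ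
    | monomial n a =>
      rw [← C_mul_X_pow_eq_monomial, map_mul, map_pow]
      exact T.mul_mem (hT₁ a) (T.pow_mem hT₂ n)
  have hT : ∀ r, r ∈ T := fun r => by
    induction r using Polynomial.induction_on' with
    | add P Q hP hQ => exact T.add_mem hP hQ
    | monomial n P =>
      rw [← C_mul_X_pow_eq_monomial]
      exact T.mul_mem (hT₄ P) (T.pow_mem hT₃ n)
  exact fittingIdeal_map_ringEquiv (Bivariate.swap (R := R)).toRingEquiv g hT

end Commuting

/-! ### Characteristic polynomials of intertwined matrices -/

/-- The matrix `E` also intertwines the characteristic matrices, and over a domain its nonzero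
determinant cancels. Invertibility is not asked for: the application has `det E` divisible by powers
of `T`. -/
theorem charpoly_eq_of_mul_eq_mul {R ι : Type*} [CommRing R] [IsDomain R] [Fintype ι]
    [DecidableEq ι] {A B E : Matrix ι ι R} (hE : E.det ≠ 0) (h : A * E = E * B) :
    A.charpoly = B.charpoly := by
  have key : A.charmatrix * E.map C = E.map C * B.charmatrix := by
    rw [Matrix.charmatrix, Matrix.charmatrix, sub_mul, mul_sub]
    congr 1
    · exact Matrix.scalar_commute _ (fun r => Commute.all _ _) _
    · change A.map C * E.map C = E.map C * B.map C
      rw [← Matrix.map_mul, ← Matrix.map_mul, h]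
  have h2 := congrArg Matrix.det key
  rw [Matrix.det_mul, Matrix.det_mul, mul_comm] at h2
  have h3 : (E.map C).det ≠ 0 := by
    change ((C : R →+* R[X]).mapMatrix E).det ≠ 0
    rw [← RingHom.map_det]
    simpa using hE
  exact mul_left_cancel₀ h3 h2

/-! ### Moore determinants -/

section Moore

variable {𝔽 F : Type*} [Field 𝔽] [Fintype 𝔽] [Field F] [Algebra 𝔽 F] [Finite F]

/-- The Moore determinant of a basis does not vanish. -/
theorem det_moore_ne_zero (b : Module.Basis (Fin (Module.finrank 𝔽 F)) 𝔽 F) :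
    (Matrix.of fun k a : Fin (Module.finrank 𝔽 F) => b a ^ Fintype.card 𝔽 ^ (k : ℕ)).det ≠ 0 := by
  intro h0
  obtain ⟨w, hw, h⟩ := Matrix.exists_vecMul_eq_zero_iff.2 h0
  -- A vector in the left kernel is a linear relation, tested on a basis, between `x ↦ x ^ (q ^ k)`
  -- for `k < d`. These are distinct `𝔽`-algebra maps, hence independent by Dedekind.
  have hli := (linearIndependent_algHom_toLinearMap 𝔽 F F).comp _
    (FiniteField.bijective_frobeniusAlgHom_pow 𝔽 F).1
  refine hw (funext (Fintype.linearIndependent_iff.1 hli w ?_))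
  refine b.ext fun a => ?_
  have := congrFun h a
  simpa [Matrix.vecMul, dotProduct, TwistedPolynomial.iterate_frobenius, pow_iterate] using this

end Moore

/-! ### Twisted polynomials as a module over the polynomials in a power of Frobenius -/

section FrobeniusModule

variable {𝔽 F : Type*} [Field 𝔽] [Fintype 𝔽] [Field F] [Algebra 𝔽 F]

namespace TwistedPolynomial

theorem eq_sum_monomial {f : TwistedPolynomial 𝔽 F} {N : ℕ} (hf : ∀ n, N < n → f.coeff n = 0) :
    f = ∑ j ∈ Finset.range (N + 1), monomial 𝔽 j (f.coeff j) := by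
  ext n
  have hs := map_sum (AddMonoidHom.mk' (fun f : TwistedPolynomial 𝔽 F => f.coeff n)
    fun f g => coeff_add f g n) (fun j => monomial 𝔽 j (f.coeff j)) (Finset.range (N + 1))
  simp only [AddMonoidHom.mk'_apply, coeff_monomial, Finset.sum_ite_eq', Finset.mem_range] at hs
  rw [hs]
  split_ifs with h
  · rfl
  · exact hf n (by omega)

end TwistedPolynomial

variable [Finite F]

theorem pow_card_pow_finrank (a : F) : a ^ Fintype.card 𝔽 ^ Module.finrank 𝔽 F = a := by
  have : Fintype F := Fintype.ofFinite F
  rw [← Module.card_eq_pow_finrank, FiniteField.pow_card]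

theorem pow_card_pow_finrank_mul (a : F) (n : ℕ) :
    a ^ Fintype.card 𝔽 ^ (Module.finrank 𝔽 F * n) = a := by
  induction n with
  | zero => simp
  | succ n ih => rw [mul_add, pow_add, pow_mul, ih, mul_one, pow_card_pow_finrank]

theorem pow_card_pow_mod_finrank (a : F) (n : ℕ) :
    a ^ Fintype.card 𝔽 ^ (n % Module.finrank 𝔽 F) = a ^ Fintype.card 𝔽 ^ n := by
  conv_rhs => rw [← Nat.div_add_mod n (Module.finrank 𝔽 F), pow_add, pow_mul,
    pow_card_pow_finrank_mul]

namespace TwistedPolynomial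

variable (𝔽 F) in
/-- Left multiplication by `τ ^ d` on `F{τ}`, where `d = [F : 𝔽]`. -/
def frobeniusMul : TwistedPolynomial 𝔽 F →ₗ[F] TwistedPolynomial 𝔽 F where
  toFun f := monomial 𝔽 (Module.finrank 𝔽 F) 1 * f
  map_add' f g := mul_add _ f g
  map_smul' a f := by
    rw [RingHom.id_apply, ← const_mul, ← const_mul, ← mul_assoc, ← mul_assoc]
    congr 1
    rw [const_apply, monomial_mul_monomial, monomial_mul_monomial, pow_card_pow_finrank]
    simp

theorem frobeniusMul_apply (f : TwistedPolynomial 𝔽 F) :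
    frobeniusMul 𝔽 F f = monomial 𝔽 (Module.finrank 𝔽 F) 1 * f := rfl

theorem monomial_smul_of_monomial (k i : ℕ) (a c : F) :
    (Polynomial.monomial k a : F[X]) • Module.AEval'.of (frobeniusMul 𝔽 F) (monomial 𝔽 i c) =
      Module.AEval'.of (frobeniusMul 𝔽 F)
        (monomial 𝔽 (Module.finrank 𝔽 F * k + i) (a * c)) := by
  induction k generalizing i c with
  | zero =>
    rw [monomial_zero_left, Module.AEval.C_smul, ← map_smul, smul_monomial, mul_zero, zero_add]
  | succ k ih =>
    rw [← Polynomial.monomial_mul_X, mul_smul, Module.AEval'.X_smul_of, frobeniusMul_apply,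
      monomial_mul_monomial, one_mul, pow_card_pow_finrank, ih]
    congr 2
    ring

/-- The variable acts as `τ ^ d`, so `P • τ ^ i` lives in the degrees congruent to `i` modulo `d`.
Multiples of different `τ ^ i` therefore have disjoint supports, whence linear independence. -/
theorem coeff_smul_of_monomial (P : F[X]) {i : ℕ} (hi : i < Module.finrank 𝔽 F) (n : ℕ) :
    ((Module.AEval'.of (frobeniusMul 𝔽 F)).symm
      (P • Module.AEval'.of (frobeniusMul 𝔽 F) (monomial 𝔽 i 1))).coeff n =
        if n % Module.finrank 𝔽 F = i then P.coeff (n / Module.finrank 𝔽 F) else 0 := by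
  induction P using Polynomial.induction_on' with
  | add P Q hP hQ =>
    rw [add_smul, map_add, coeff_add, hP, hQ, Polynomial.coeff_add]
    split_ifs <;> simp
  | monomial k a =>
    rw [monomial_smul_of_monomial, LinearEquiv.symm_apply_apply, coeff_monomial, mul_one,
      Polynomial.coeff_monomial, ← ite_and]
    refine if_congr ?_ rfl rfl
    have hd : 0 < Module.finrank 𝔽 F := by omega
    constructor
    · rintro rfl
      rw [Nat.mul_add_mod, Nat.mod_eq_of_lt hi, Nat.mul_add_div hd, Nat.div_eq_of_lt hi]
      simp
    · rintro ⟨rfl, rfl⟩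
      exact Nat.div_add_mod n _

variable (𝔽 F) in
/-- The elements `1, τ, …, τ ^ (d - 1)` form a basis of `F{τ}` over the polynomials in `τ ^ d`. -/
def frobeniusBasis : Module.Basis (Fin (Module.finrank 𝔽 F)) F[X]
    (Module.AEval' (frobeniusMul 𝔽 F)) :=
  Module.Basis.mk (v := fun i => Module.AEval'.of (frobeniusMul 𝔽 F) (monomial 𝔽 i 1))
    (by
      rw [Fintype.linearIndependent_iff]
      intro c hc i
      ext k
      -- In degree `d k + i` only the `i`-th summand contributes, namely by the `k`-th coefficient
      -- of `c i`.
      have h := congrArg (fun z => ((Module.AEval'.of (frobeniusMul 𝔽 F)).symm z).coeff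
        (Module.finrank 𝔽 F * k + i)) hc
      have hs : ∀ z : Fin (Module.finrank 𝔽 F) → TwistedPolynomial 𝔽 F, ∀ n,
          (∑ j, z j).coeff n = ∑ j, (z j).coeff n := fun z n =>
        map_sum (AddMonoidHom.mk' (fun f : TwistedPolynomial 𝔽 F => f.coeff n)
          fun f g => coeff_add f g n) z _
      have hd : 0 < Module.finrank 𝔽 F := i.pos
      simp only [map_sum, hs, coeff_smul_of_monomial _ (Fin.is_lt _), map_zero, coeff_zero,
        Nat.mul_add_mod, Nat.mod_eq_of_lt i.is_lt, Nat.mul_add_div hd, Nat.div_eq_of_lt i.is_lt,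
        add_zero, ← Fin.ext_iff, Finset.sum_ite_eq, Finset.mem_univ, if_true] at h
      rw [h, Polynomial.coeff_zero])
    (by
      intro z _
      obtain ⟨f, rfl⟩ := (Module.AEval'.of (frobeniusMul 𝔽 F)).surjective z
      induction f using TwistedPolynomial.induction with
      | hz => rw [map_zero]; exact Submodule.zero_mem _
      | ha f g hf hg => rw [map_add]; exact Submodule.add_mem _ (hf trivial) (hg trivial)
      | hm n a =>
        have h := monomial_smul_of_monomial (𝔽 := 𝔽) (n / Module.finrank 𝔽 F)
          (n % Module.finrank 𝔽 F) a 1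
        rw [Nat.div_add_mod, mul_one] at h
        rw [← h]
        exact Submodule.smul_mem _ _ (Submodule.subset_span
          ⟨⟨n % Module.finrank 𝔽 F, Nat.mod_lt _ Module.finrank_pos⟩, rfl⟩))

theorem frobeniusBasis_apply (i : Fin (Module.finrank 𝔽 F)) :
    frobeniusBasis 𝔽 F i = Module.AEval'.of (frobeniusMul 𝔽 F) (monomial 𝔽 i 1) :=
  Module.Basis.mk_apply _ _ i

theorem of_monomial_eq_smul_frobeniusBasis (n : ℕ) (a : F) :
    Module.AEval'.of (frobeniusMul 𝔽 F) (monomial 𝔽 n a) =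
      (Polynomial.monomial (n / Module.finrank 𝔽 F) a : F[X]) • frobeniusBasis 𝔽 F
        ⟨n % Module.finrank 𝔽 F, Nat.mod_lt _ Module.finrank_pos⟩ := by
  rw [frobeniusBasis_apply, monomial_smul_of_monomial, mul_one, Nat.div_add_mod]

end TwistedPolynomial

end FrobeniusModule

/-! ### The two commuting actions of `τ ^ d` and `φ_t` on `F{τ}` -/

namespace DrinfeldModule

open TwistedPolynomial

variable {𝔽 F : Type*} [Field 𝔽] [Fintype 𝔽] [Field F] [Algebra 𝔽 F]
variable {γ : 𝔽[X] →ₐ[𝔽] F} (φ : DrinfeldModule γ)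

theorem tauMul_iterate_of (n : ℕ) (f : TwistedPolynomial 𝔽 F) :
    φ.tauMul^[n] (φ.of f) = φ.of (monomial 𝔽 n 1 * f) := by
  induction n with
  | zero => rw [← one_def, one_mul]; rfl
  | succ n ih =>
    rw [Function.iterate_succ_apply', ih, tauMul_of, ← mul_assoc, tau, TwistedPolynomial.monomial_mul_monomial,
      one_pow, one_mul, add_comm]

variable [Finite F]

theorem rightMul_frobeniusMul (f : TwistedPolynomial 𝔽 F) :
    φ.rightMul (frobeniusMul 𝔽 F f) = frobeniusMul 𝔽 F (φ.rightMul f) :=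
  mul_assoc _ _ _

/-- Right multiplication by `φ_t` as an endomorphism over the polynomials in `τ ^ d`. -/
def rightMulEnd : Module.AEval' (frobeniusMul 𝔽 F) →ₗ[F[X]] Module.AEval' (frobeniusMul 𝔽 F) :=
  commutingEnd (frobeniusMul 𝔽 F) φ.rightMul φ.rightMul_frobeniusMul

theorem iterateSemilinear_tauMul :
    iterateSemilinear φ.tauMul (Module.finrank 𝔽 F) (frobeniusPoly_iterate rfl) =
      commutingEnd φ.rightMul (frobeniusMul 𝔽 F) (fun f => (φ.rightMul_frobeniusMul f).symm) := by
  ext x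
  obtain ⟨f, rfl⟩ := φ.of.surjective x
  exact φ.tauMul_iterate_of _ f

/-- The matrix of right multiplication by `φ_t` with respect to the powers of `τ`. -/
def frobeniusMatrix : Matrix (Fin (Module.finrank 𝔽 F)) (Fin (Module.finrank 𝔽 F)) F[X] :=
  Matrix.of fun i k => ∑ j ∈ Finset.range (φ.rank + 1),
    if (i + j) % Module.finrank 𝔽 F = k then
      Polynomial.monomial ((i + j) / Module.finrank 𝔽 F)
        ((φ.toAlgHom X).coeff j ^ Fintype.card 𝔽 ^ (i : ℕ))
    else 0

theorem rightMulEnd_frobeniusBasis (i : Fin (Module.finrank 𝔽 F)) :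
    φ.rightMulEnd (frobeniusBasis 𝔽 F i) =
      ∑ k, φ.frobeniusMatrix i k • frobeniusBasis 𝔽 F k := by
  rw [frobeniusBasis_apply, rightMulEnd, commutingEnd_of]
  change Module.AEval'.of _ (monomial 𝔽 i 1 * φ.toAlgHom X) = _
  conv_lhs => rw [eq_sum_monomial φ.hasDegree.2]
  rw [Finset.mul_sum, map_sum]
  simp only [frobeniusMatrix, Matrix.of_apply, Finset.sum_smul]
  rw [Finset.sum_comm]
  refine Finset.sum_congr rfl fun j _ => ?_
  rw [TwistedPolynomial.monomial_mul_monomial, one_mul, of_monomial_eq_smul_frobeniusBasis,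
    Finset.sum_eq_single ⟨(i + j) % Module.finrank 𝔽 F, Nat.mod_lt _ Module.finrank_pos⟩]
  · rw [if_pos rfl]
  · intro k _ hk
    rw [if_neg fun h => hk (Fin.ext h.symm), zero_smul]
  · intro h
    exact absurd (Finset.mem_univ _) h

theorem charpoly_rightMulEnd :
    haveI := Module.Free.of_basis (frobeniusBasis 𝔽 F)
    haveI := Module.Finite.of_basis (frobeniusBasis 𝔽 F)
    φ.rightMulEnd.charpoly = φ.frobeniusMatrix.charpoly := by
  have := Module.Free.of_basis (frobeniusBasis 𝔽 F)
  have := Module.Finite.of_basis (frobeniusBasis 𝔽 F)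
  -- `frobeniusMatrix` has the images of the basis as rows, `LinearMap.toMatrix` as columns.
  rw [← LinearMap.charpoly_toMatrix _ (frobeniusBasis 𝔽 F), ← Matrix.charpoly_transpose]
  congr 1
  ext1 i k
  rw [Matrix.transpose_apply, LinearMap.toMatrix_apply, rightMulEnd_frobeniusBasis, map_sum]
  simp [Finsupp.single_apply]

/-- The characteristic polynomial of `τ ^ d` on `M(φ)` and that of `φ_t` on `F{τ}`, seen as a
module over the polynomials in `τ ^ d`, agree up to a unit. -/
theorem associated_charpoly_frobenius :
    haveI := φ.free_motiveModule
    haveI := φ.finite_motiveModule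
    Associated (Bivariate.swap φ.frobeniusMatrix.charpoly)
      (iterateSemilinear φ.tauMul (Module.finrank 𝔽 F) (frobeniusPoly_iterate rfl)).charpoly := by
  have := φ.free_motiveModule
  have := φ.finite_motiveModule
  have := Module.Free.of_basis (frobeniusBasis 𝔽 F)
  have := Module.Finite.of_basis (frobeniusBasis 𝔽 F)
  -- In `h₁` the inner variable is `t` and the outer one `τ ^ d`; in `h₂` it is the other way round.
  -- `h₃` identifies the two Fitting ideals after swapping the variables.
  have h₁ := fittingIdeal_AEval' (commutingEnd φ.rightMul (frobeniusMul 𝔽 F)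
    (fun f => (φ.rightMul_frobeniusMul f).symm))
  have h₂ := fittingIdeal_AEval' φ.rightMulEnd
  have h₃ := fittingIdeal_commutingEnd_swap _ _ φ.rightMul_frobeniusMul
    (fun f => (φ.rightMul_frobeniusMul f).symm)
  rw [charpoly_rightMulEnd] at h₂
  rw [h₁, ← rightMulEnd, h₂, Ideal.map_span, Set.image_singleton] at h₃
  rw [iterateSemilinear_tauMul]
  exact Ideal.span_singleton_eq_span_singleton.1 h₃

end DrinfeldModule

/-! ### Comparison with the twisted module -/

section Comparison

variable {𝔽 F : Type*} [Field 𝔽] [Field F] [Algebra 𝔽 F]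

/-- The outer variable is `t` in the source `𝔽[T][t]` but `T` in the target `F[t][T]`, hence the
swap. -/
theorem coeffMap_eq_swap (Q : 𝔽[X][X]) :
    coeffMap 𝔽 F F[X] Q = Bivariate.swap (Q.map (mapRingHom (algebraMap 𝔽 F))) := by
  have h : coeffMap 𝔽 F F[X] = (Bivariate.swap (R := F) : F[X][X] →+* F[X][X]).comp
      (mapRingHom (mapRingHom (algebraMap 𝔽 F))) := by
    ext <;> simp [coeffMap, Bivariate.swap_apply]
  rw [h]
  rfl

theorem coeffMap_eq_map (S : Type*) [CommRing S] [Algebra F[X] S] (Q : 𝔽[X][X]) :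
    coeffMap 𝔽 F S Q = (coeffMap 𝔽 F F[X] Q).map (algebraMap F[X] S) := by
  have h : coeffMap 𝔽 F S = (mapRingHom (algebraMap F[X] S)).comp (coeffMap 𝔽 F F[X]) := by
    ext <;> simp [coeffMap]
  rw [h]
  rfl

/-- Used to move the substitution `s = T ^ d` from the coefficients, where it compares matrices, to
the outer variable, where it appears in `frobeniusCharpoly`. -/
theorem expand_swap {F : Type*} [Field F] (n : ℕ) (Q : F[X][X]) :
    expand F[X] n (Bivariate.swap Q) =
      Bivariate.swap (Q.map (expand F n : F[X] →ₐ[F] F[X]).toRingHom) := by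
  have h : ((expand F[X] n : F[X][X] →ₐ[F[X]] F[X][X]) : F[X][X] →+* F[X][X]).comp
      (Bivariate.swap (R := F) : F[X][X] →+* F[X][X]) =
      (Bivariate.swap (R := F) : F[X][X] →+* F[X][X]).comp
        (mapRingHom (expand F n : F[X] →ₐ[F] F[X]).toRingHom) := by
    ext <;> simp [Bivariate.swap_apply]
  exact congrArg (fun f : F[X][X] →+* F[X][X] => f Q) h

variable [Fintype 𝔽]

variable (𝔽 F) in
/-- The map `𝔽[T] ⊗ F → F[T]`, `P ⊗ x ↦ x ^ (q ^ i) T ^ i P`. -/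
def conjugateMap (i : ℕ) :
    𝔽[X] ⊗[𝔽] F →ₛₗ[mapRingHom (algebraMap 𝔽 F)] F[X] :=
  extendSemilinear (mapRingHom (algebraMap 𝔽 F))
    ((Polynomial.monomial i).toAddMonoidHom.comp
      ((FiniteField.frobeniusAlgHom 𝔽 F ^ i : F →ₐ[𝔽] F) : F →+ F))
    (fun c x => by
      change Polynomial.monomial i ((FiniteField.frobeniusAlgHom 𝔽 F ^ i) (c • x)) =
        mapRingHom (algebraMap 𝔽 F) (C c) •
          Polynomial.monomial i ((FiniteField.frobeniusAlgHom 𝔽 F ^ i) x)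
      rw [map_smul, Algebra.smul_def, Polynomial.coe_mapRingHom, Polynomial.map_C, smul_eq_mul,
        C_mul_monomial])

theorem frobeniusAlgHom_pow_apply (n : ℕ) (x : F) :
    (FiniteField.frobeniusAlgHom 𝔽 F ^ n) x = x ^ Fintype.card 𝔽 ^ n := by
  rw [AlgHom.coe_pow, TwistedPolynomial.iterate_frobenius]

theorem conjugateMap_tmul (i : ℕ) (P : 𝔽[X]) (x : F) :
    conjugateMap 𝔽 F i (P ⊗ₜ x) =
      P.map (algebraMap 𝔽 F) * Polynomial.monomial i (x ^ Fintype.card 𝔽 ^ i) := by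
  rw [← frobeniusAlgHom_pow_apply]
  rfl

namespace DrinfeldModule

variable {γ : 𝔽[X] →ₐ[𝔽] F} (φ : DrinfeldModule γ)

/-- Raising `g_j T ^ j x ^ (q ^ j)` to the power `q ^ i` on `F` and multiplying by `T ^ i` yields
the same coefficients `g_j ^ (q ^ i)` and degrees `i + j` as `τ ^ i φ_t`. -/
theorem conjugateMap_twistedEnd (i : ℕ) (x : F) :
    conjugateMap 𝔽 F i (φ.twistedEnd (1 ⊗ₜ x)) =
      ∑ j ∈ Finset.range (φ.rank + 1), Polynomial.monomial (i + j)
        ((φ.toAlgHom X).coeff j ^ Fintype.card 𝔽 ^ i * x ^ Fintype.card 𝔽 ^ (i + j)) := by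
  rw [twistedEnd, LinearMap.sum_apply, map_sum]
  refine Finset.sum_congr rfl fun j _ => ?_
  rw [LinearMap.smul_apply, LinearMap.baseChange_tmul, map_smulₛₗ, conjugateMap_tmul]
  change _ • (_ * Polynomial.monomial i
    (((φ.toAlgHom X).coeff j * (FiniteField.frobeniusAlgHom 𝔽 F ^ j) x) ^ _)) = _
  rw [frobeniusAlgHom_pow_apply, mul_pow, ← pow_mul, ← pow_add, add_comm j i]
  simp [Polynomial.X_pow_mul_monomial]

variable [Finite F]

theorem twistedDet_eq_charpoly : φ.twistedDet = φ.twistedEnd.charpoly :=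
  detSub_X_one _

/-- The maps `conjugateMap 𝔽 F i` for `i < d`, evaluated on an `𝔽`-basis of `F`, form a matrix `E`
that intertwines `φ^∼_t` with the matrix of `φ_t` over `F[τ ^ d]` at `τ ^ d = T ^ d`. It factors as
`diag (T ^ k)` times a Moore matrix, so its determinant is nonzero. -/
theorem map_charpoly_twistedEnd :
    φ.twistedEnd.charpoly.map (mapRingHom (algebraMap 𝔽 F)) =
      φ.frobeniusMatrix.charpoly.map
        (expand F (Module.finrank 𝔽 F) : F[X] →ₐ[F] F[X]).toRingHom := by
  let b := Module.finBasis 𝔽 F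
  let v := Algebra.TensorProduct.basis 𝔽[X] b
  let E : Matrix (Fin (Module.finrank 𝔽 F)) (Fin (Module.finrank 𝔽 F)) F[X] :=
    Matrix.of fun k a => conjugateMap 𝔽 F k (v a)
  have hv : ∀ a, v a = 1 ⊗ₜ b a := Algebra.TensorProduct.basis_apply b
  have hEapp : ∀ k a, E k a = Polynomial.monomial (k : ℕ) (b a ^ Fintype.card 𝔽 ^ (k : ℕ)) := by
    intro k a
    simp only [E, Matrix.of_apply, hv, conjugateMap_tmul, Polynomial.map_one, one_mul]
  have hE : E.det ≠ 0 := by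
    have e : E = Matrix.diagonal (fun k : Fin (Module.finrank 𝔽 F) => (X : F[X]) ^ (k : ℕ)) *
        (C : F →+* F[X]).mapMatrix
          (Matrix.of fun k a : Fin (Module.finrank 𝔽 F) => b a ^ Fintype.card 𝔽 ^ (k : ℕ)) := by
      ext1 k a
      rw [hEapp, Matrix.diagonal_mul, RingHom.mapMatrix_apply, Matrix.map_apply, Matrix.of_apply,
        X_pow_mul_C, C_mul_X_pow_eq_monomial]
    rw [e, Matrix.det_mul, Matrix.det_diagonal, ← RingHom.map_det]
    refine mul_ne_zero (Finset.prod_ne_zero_iff.2 fun k _ => pow_ne_zero _ X_ne_zero) ?_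
    rw [Ne, C_eq_zero]
    exact det_moore_ne_zero b
  rw [← LinearMap.charpoly_toMatrix _ v, ← Matrix.charpoly_map, ← Matrix.charpoly_map]
  refine (charpoly_eq_of_mul_eq_mul hE ?_).symm
  ext1 i a
  have h₁ : (E * (LinearMap.toMatrix v v φ.twistedEnd).map (mapRingHom (algebraMap 𝔽 F))) i a =
      conjugateMap 𝔽 F i (φ.twistedEnd (v a)) := by
    conv_rhs => rw [← v.sum_repr (φ.twistedEnd (v a)), map_sum]
    rw [Matrix.mul_apply]
    refine Finset.sum_congr rfl fun c _ => ?_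
    rw [map_smulₛₗ, Matrix.map_apply, LinearMap.toMatrix_apply, smul_eq_mul, mul_comm]
    rfl
  rw [h₁, hv, conjugateMap_twistedEnd, Matrix.mul_apply]
  simp only [Matrix.map_apply, frobeniusMatrix, Matrix.of_apply, map_sum, Finset.sum_mul]
  rw [Finset.sum_comm]
  refine Finset.sum_congr rfl fun j _ => ?_
  -- Dividing `i + j` by `d`, the quotient enters through the substitution `T ^ d` and the remainder
  -- through `E`. Reducing the Frobenius exponent modulo `d` changes nothing on `F`.
  rw [Finset.sum_eq_single ⟨(i + j) % Module.finrank 𝔽 F, Nat.mod_lt _ Module.finrank_pos⟩]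
  · rw [if_pos rfl, hEapp]
    change expand F _ (Polynomial.monomial _ _) * _ = _
    rw [expand_monomial, Polynomial.monomial_mul_monomial, pow_card_pow_mod_finrank, mul_comm (_ / _),
      Nat.div_add_mod]
  · intro k _ hk
    rw [if_neg fun h => hk (Fin.ext h.symm), map_zero, zero_mul]
  · intro h
    exact absurd (Finset.mem_univ _) h

theorem frobeniusCharpoly_eq_expand :
    haveI := φ.free_motiveModule
    haveI := φ.finite_motiveModule
    φ.frobeniusCharpoly = expand F[X] (Module.finrank 𝔽 F)
      (iterateSemilinear φ.tauMul (Module.finrank 𝔽 F) (frobeniusPoly_iterate rfl)).charpoly := by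
  have := φ.free_motiveModule
  have := φ.finite_motiveModule
  rw [frobeniusCharpoly, detSub_one_right, expand_eq_comp_X_pow]
  rfl

/-- Combines the comparison over `F[s, t]` with the conjugation. Only a unit is lost, since the
former compares generators of an ideal. -/
theorem associated_frobeniusCharpoly :
    Associated (coeffMap 𝔽 F F[X] φ.twistedDet) φ.frobeniusCharpoly := by
  rw [frobeniusCharpoly_eq_expand, coeffMap_eq_swap, twistedDet_eq_charpoly,
    map_charpoly_twistedEnd, ← expand_swap]
  exact φ.associated_charpoly_frobenius.map
    (expand F[X] (Module.finrank 𝔽 F) : F[X][X] →ₐ[F[X]] F[X][X])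

theorem fittingIdeal_twistedModule :
    fittingIdeal 𝔽[X][X] φ.TwistedModule = Ideal.span {φ.twistedDet} := by
  rw [twistedDet_eq_charpoly]
  exact fittingIdeal_AEval' _

theorem map_fittingIdeal_twistedModule :
    (fittingIdeal 𝔽[X][X] φ.TwistedModule).map (coeffMap 𝔽 F F[X]) =
      Ideal.span {φ.frobeniusCharpoly} := by
  rw [fittingIdeal_twistedModule, Ideal.map_span, Set.image_singleton,
    Ideal.span_singleton_eq_span_singleton]
  exact φ.associated_frobeniusCharpoly

end DrinfeldModule

end Comparison

/-! ### Duality and Euler factors -/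

section Contragredient

/-- Since `Aᵀ B = 1`, one has `(-Aᵀ) (1 - a B) = a - Aᵀ`; transposing does not change determinants.
-/
theorem det_smul_one_sub_of_transpose_mul_eq_one {S ι : Type*} [CommRing S] [Fintype ι]
    [DecidableEq ι] {A B : Matrix ι ι S} (h : B.transpose * A = 1) (a : S) :
    (-A).det * (1 - a • B).det = (a • 1 - A).det := by
  have h' : A.transpose * B = 1 := by
    have := congrArg Matrix.transpose h
    rwa [Matrix.transpose_mul, Matrix.transpose_transpose, Matrix.transpose_one] at this
  rw [← Matrix.det_transpose (-A), ← Matrix.det_mul, ← Matrix.det_transpose (a • 1 - A)]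
  congr 1
  rw [mul_sub, mul_one, Matrix.mul_smul, Matrix.transpose_neg, neg_mul, h', Matrix.transpose_sub,
    Matrix.transpose_smul, Matrix.transpose_one, smul_neg]
  abel

/-- If `g` is the contragredient of `f` then `det (-f) det (1 - a g) = det (a - f)`. -/
theorem det_neg_mul_detSub {R V W S : Type*} [CommRing R] [AddCommGroup V] [Module R V]
    [Module.Free R V] [Module.Finite R V] [AddCommGroup W] [Module R W] [CommRing S] [Algebra R S]
    (e : W ≃ₗ[R] Module.Dual R V) (f : V →ₗ[R] V) (g : W →ₗ[R] W)
    (h : ∀ w v, e (g w) (f v) = e w v) (a : S) :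
    algebraMap R S (LinearMap.det (-f)) * detSub 1 a g = detSub a 1 f := by
  classical
  let b := Module.Free.chooseBasis R V
  let b' := b.dualBasis.map e.symm
  set A := LinearMap.toMatrix b b f with hA
  set B := LinearMap.toMatrix b' b' g with hB
  have hb' : ∀ i, e (b' i) = b.dualBasis i := fun i => by simp [b']
  -- Invariance of the pairing, written in dual bases.
  have hBA : B.transpose * A = 1 := by
    ext1 i j
    have h₁ := h (b' i) (b j)
    rw [← b'.sum_repr (g (b' i)), ← b.sum_repr (f (b j)), hb'] at h₁
    simp only [map_sum, map_smul, LinearMap.sum_apply, LinearMap.smul_apply, hb',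
      Module.Basis.dualBasis_apply_self, smul_eq_mul] at h₁
    rw [Matrix.mul_apply, Matrix.one_apply]
    simp only [Matrix.transpose_apply, hA, hB, LinearMap.toMatrix_apply]
    simpa [Finsupp.single_apply, eq_comm, mul_comm] using h₁
  rw [detSub_eq_det b, detSub_eq_det b', ← LinearMap.det_toMatrix b, map_neg, RingHom.map_det,
    one_smul, one_smul, ← hA, ← hB]
  rw [← det_smul_one_sub_of_transpose_mul_eq_one (A := A.map (algebraMap R S))
    (B := B.map (algebraMap R S))]
  · congr 2
    ext; simp
  · rw [← Matrix.transpose_map, ← Matrix.map_mul, hBA]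
    simp

end Contragredient

/-! ### The value at `T = 0` -/

/-- By Cayley-Hamilton the characteristic polynomial of `γ t` lies in `ker γ`, so `p` divides it;
both are monic of degree `[F : 𝔽]`. -/
theorem charpoly_lmul_eq {𝔽 F : Type*} [Field 𝔽] [Field F] [Algebra 𝔽 F] [Module.Finite 𝔽 F]
    {γ : 𝔽[X] →ₐ[𝔽] F} {p : 𝔽[X]} (hp : p.Monic)
    (hker : RingHom.ker γ = Ideal.span {p}) (hdeg : p.natDegree = Module.finrank 𝔽 F) :
    (Algebra.lmul 𝔽 F (γ X)).charpoly = p := by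
  have e : γ = Polynomial.aeval (γ X) := by ext; simp
  have h : (Algebra.lmul 𝔽 F (γ X)).charpoly ∈ RingHom.ker γ := by
    rw [RingHom.mem_ker]
    exact (DFunLike.congr_fun e _).trans (Algebra.aeval_self_charpoly_lmul (γ X))
  rw [hker, Ideal.mem_span_singleton] at h
  refine (Polynomial.eq_of_monic_of_dvd_of_natDegree_le hp (LinearMap.charpoly_monic _) h ?_)
  rw [LinearMap.charpoly_natDegree, hdeg]

/-! ### Invariance of the duality pairing and the Euler factor of the dual motive -/

section Dual

variable {𝔽 F : Type*} [Field 𝔽] [Fintype 𝔽] [Field F] [Algebra 𝔽 F]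
variable {γ : 𝔽[X] →ₐ[𝔽] F} {p : 𝔽[X]}

theorem toDualBaseChange_tmul_tmul {R M S : Type*} [CommRing R] [AddCommGroup M] [Module R M]
    [Module.Free R M] [Module.Finite R M] [CommRing S] [Algebra R S] (s s' : S)
    (h : Module.Dual R M) (x : M) :
    (TensorProduct.isBaseChange R M S).toDualBaseChange (s ⊗ₜ h) (s' ⊗ₜ x) =
      s' * (s * algebraMap R S (h x)) := by
  have := (TensorProduct.isBaseChange R M S).toDualBaseChange_tmul s h x
  rw [← this, ← smul_eq_mul, ← map_smul, TensorProduct.mk_apply, TensorProduct.smul_tmul',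
    smul_eq_mul, mul_one]

/-- Pairings between the base changes of a module and its dual are compatible with maps of
algebras. -/
theorem toDualBaseChange_rTensor {R M S S' : Type*} [CommRing R] [AddCommGroup M] [Module R M]
    [Module.Free R M] [Module.Finite R M] [CommRing S] [Algebra R S] [CommRing S'] [Algebra R S']
    (j : S →ₐ[R] S') (u : S ⊗[R] Module.Dual R M) (w : S ⊗[R] M) :
    (TensorProduct.isBaseChange R M S').toDualBaseChange (j.toLinearMap.rTensor _ u)
        (j.toLinearMap.rTensor _ w) =
      j ((TensorProduct.isBaseChange R M S).toDualBaseChange u w) := by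
  induction u using TensorProduct.induction_on with
  | zero => simp
  | add u u' hu hu' =>
    rw [map_add, map_add, LinearMap.add_apply, hu, hu', map_add, LinearMap.add_apply, map_add]
  | tmul s h =>
    induction w using TensorProduct.induction_on with
    | zero => simp
    | add w w' hw hw' => rw [map_add, map_add, hw, hw', map_add, map_add]
    | tmul s' x =>
      rw [LinearMap.rTensor_tmul, LinearMap.rTensor_tmul, toDualBaseChange_tmul_tmul,
        toDualBaseChange_tmul_tmul]
      simp

namespace AndersonMotive

variable {M : Type*} [AddCommGroup M] [Module F[X] M] (m : AndersonMotive γ M)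

theorem frobAway_tmul (hker : RingHom.ker γ = Ideal.span {p}) (s : AwayPrime F p) (x : M) :
    m.frobAway hker (s ⊗ₜ x) = frobeniusAway F p s • m.frobRestrict hker x :=
  rfl

/-- As `τ_{M^∨} h = h ∘ τ_M⁻¹`, the Frobenius of `M` cancels and the pairing of the images is `τ (h
x)`. The cancellation takes place over `A_F[1 / (t - θ)]`, where `τ_M` is an isomorphism, and is
then carried to `A_F[1 / p]`. -/
theorem frobRestrict_dual_apply [Module.Free F[X] M] [Module.Finite F[X] M]
    (hker : RingHom.ker γ = Ideal.span {p}) (h : Module.Dual F[X] M) (x : M) :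
    (TensorProduct.isBaseChange F[X] M (AwayPrime F p)).toDualBaseChange
        (m.dual.frobRestrict hker h) (m.frobRestrict hker x) =
      algebraMap F[X] (AwayPrime F p) (frobeniusPoly 𝔽 F (h x)) := by
  refine (toDualBaseChange_rTensor (awayThetaToPrime hker) _ _).trans ?_
  rw [← AlgHom.commutes (awayThetaToPrime hker)]
  congr 1
  have h₁ : (TensorProduct.isBaseChange F[X] M (AwayTheta γ)).toDualBaseChange
      (m.dual.frob (1 ⊗ₜ Pullback.mk (frobeniusPoly 𝔽 F) h)) =
      m.frob.symm.dualMap ((TensorProduct.isBaseChange F[X] (Pullback (frobeniusPoly 𝔽 F) M)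
        (AwayTheta γ)).toDualBaseChange
          (1 ⊗ₜ Pullback.dualEquiv (frobeniusPoly 𝔽 F) M (Pullback.mk _ h))) :=
    LinearEquiv.apply_symm_apply _ _
  rw [h₁, LinearEquiv.dualMap_apply, LinearEquiv.symm_apply_apply]
  refine ((TensorProduct.isBaseChange F[X] (Pullback (frobeniusPoly 𝔽 F) M)
    (AwayTheta γ)).toDualBaseChange_tmul 1 _ (Pullback.mk _ x)).trans ?_
  rw [one_mul, Pullback.dualEquiv_mk]

theorem frobAway_dual_apply [Module.Free F[X] M] [Module.Finite F[X] M]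
    (hker : RingHom.ker γ = Ideal.span {p}) (u : AwayPrime F p ⊗[F[X]] Module.Dual F[X] M)
    (w : AwayPrime F p ⊗[F[X]] M) :
    (TensorProduct.isBaseChange F[X] M (AwayPrime F p)).toDualBaseChange
        (m.dual.frobAway hker u) (m.frobAway hker w) =
      frobeniusAway F p
        ((TensorProduct.isBaseChange F[X] M (AwayPrime F p)).toDualBaseChange u w) := by
  induction u using TensorProduct.induction_on with
  | zero => simp
  | add u u' hu hu' =>
    rw [map_add, map_add, LinearMap.add_apply, hu, hu', map_add, LinearMap.add_apply, map_add]
  | tmul s h =>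
    induction w using TensorProduct.induction_on with
    | zero => simp
    | add w w' hw hw' => rw [map_add, map_add, hw, hw', map_add, map_add]
    | tmul s' x =>
      rw [frobAway_tmul, frobAway_tmul, map_smul, map_smul, LinearMap.smul_apply,
        frobRestrict_dual_apply, toDualBaseChange_tmul_tmul, map_mul, map_mul, frobeniusAway_algebraMap, smul_eq_mul,
        smul_eq_mul, mul_left_comm]

theorem iterate_frobAway_dual_apply [Finite F] [Module.Free F[X] M] [Module.Finite F[X] M]
    (hker : RingHom.ker γ = Ideal.span {p}) (n : ℕ)
    (u : AwayPrime F p ⊗[F[X]] Module.Dual F[X] M) (w : AwayPrime F p ⊗[F[X]] M) :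
    (TensorProduct.isBaseChange F[X] M (AwayPrime F p)).toDualBaseChange
        ((m.dual.frobAway hker)^[n] u) ((m.frobAway hker)^[n] w) =
      (frobeniusAway F p)^[n]
        ((TensorProduct.isBaseChange F[X] M (AwayPrime F p)).toDualBaseChange u w) := by
  induction n with
  | zero => rfl
  | succ n ih => simp only [Function.iterate_succ_apply', frobAway_dual_apply, ih]

/-- The Euler factor of the dual motive, in terms of the characteristic polynomial of the iterate
of Frobenius. -/
theorem det_mul_eulerFactor_dual [Finite F] (hker : RingHom.ker γ = Ideal.span {p})
    (hdeg : p.natDegree = Module.finrank 𝔽 F) :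
    C (LinearMap.det (-iterateSemilinear (m.frobAway hker) p.natDegree
      (frobeniusAway_iterate p hdeg))) * m.dual.eulerFactor hker hdeg =
    detSub (X ^ p.natDegree) 1 (iterateSemilinear (m.frobAway hker) p.natDegree
      (frobeniusAway_iterate p hdeg)) := by
  have := m.free
  have := m.finite
  refine det_neg_mul_detSub (TensorProduct.isBaseChange F[X] M (AwayPrime F p)).toDualBaseChange
    _ _ (fun u w => ?_) _
  -- The pairing is invariant only up to `τ` on scalars, but `τ ^ d` is trivial on scalars, so the
  -- `d`-th iterates are contragredient.
  rw [← frobeniusAway_iterate p hdeg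
    ((TensorProduct.isBaseChange F[X] M (AwayPrime F p)).toDualBaseChange u w)]
  exact m.iterate_frobAway_dual_apply hker _ u w

theorem eval_zero_eulerFactor [Finite F] (hker : RingHom.ker γ = Ideal.span {p})
    (hdeg : p.natDegree = Module.finrank 𝔽 F) : (m.eulerFactor hker hdeg).eval 0 = 1 := by
  classical
  have := m.free
  have := m.finite
  have hd : p.natDegree ≠ 0 := hdeg ▸ Module.finrank_pos.ne'
  rw [eulerFactor, detSub_eq_det (Module.Free.chooseBasis (AwayPrime F p) (AwayPrime F p ⊗[F[X]] M)),
    ← Polynomial.coe_evalRingHom, RingHom.map_det]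
  suffices h : _ = (1 : Matrix _ _ (AwayPrime F p)) from (congrArg Matrix.det h).trans Matrix.det_one
  ext i j
  by_cases h : i = j <;> simp [Matrix.one_apply, hd, h]

end AndersonMotive

namespace DrinfeldModule

variable [Finite F] (φ : DrinfeldModule γ)

theorem frobRestrict_motive (hker : RingHom.ker γ = Ideal.span {p}) (x : φ.MotiveModule) :
    φ.motive.frobRestrict hker x = 1 ⊗ₜ φ.tauMul x := by
  change (awayThetaToPrime hker).toLinearMap.rTensor _
    ((Pullback.lift φ.tauMul).baseChange (AwayTheta γ) (1 ⊗ₜ Pullback.mk _ x)) = _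
  rw [LinearMap.baseChange_tmul, Pullback.lift_mk, LinearMap.rTensor_tmul]
  simp

/-- Both sides are linear, so they are compared on `1 ⊗ x`, where each application of `τ_M` is just
left multiplication by `τ`. -/
theorem iterateSemilinear_frobAway_motive (hker : RingHom.ker γ = Ideal.span {p})
    (hdeg : p.natDegree = Module.finrank 𝔽 F) :
    iterateSemilinear (φ.motive.frobAway hker) p.natDegree (frobeniusAway_iterate p hdeg) =
      (iterateSemilinear φ.tauMul (Module.finrank 𝔽 F)
        (frobeniusPoly_iterate rfl)).baseChange (AwayPrime F p) := by
  have key : ∀ n (x : φ.MotiveModule), (φ.motive.frobAway hker)^[n] (1 ⊗ₜ x) =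
      1 ⊗ₜ[F[X]] φ.tauMul^[n] x := by
    intro n x
    induction n with
    | zero => rfl
    | succ n ih =>
      rw [Function.iterate_succ_apply', ih, AndersonMotive.frobAway_tmul, map_one, one_smul,
        frobRestrict_motive, Function.iterate_succ_apply']
  apply TensorProduct.AlgebraTensorModule.curry_injective
  ext x
  change (φ.motive.frobAway hker)^[p.natDegree] (1 ⊗ₜ x) =
    1 ⊗ₜ[F[X]] φ.tauMul^[Module.finrank 𝔽 F] x
  rw [key, hdeg]

theorem detSub_frobAway_motive (hker : RingHom.ker γ = Ideal.span {p})
    (hdeg : p.natDegree = Module.finrank 𝔽 F) :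
    detSub (X ^ p.natDegree) 1 (iterateSemilinear (φ.motive.frobAway hker) p.natDegree
      (frobeniusAway_iterate p hdeg)) =
      φ.frobeniusCharpoly.map (algebraMap F[X] (AwayPrime F p)) := by
  have := φ.free_motiveModule
  have := φ.finite_motiveModule
  rw [iterateSemilinear_frobAway_motive φ hker hdeg, detSub_one_right, LinearMap.charpoly_baseChange,
    frobeniusCharpoly_eq_expand, Polynomial.map_expand, hdeg, expand_eq_comp_X_pow]
  rfl

/-- At `T = 0` only the constant term `γ t` of `φ^∼_t` survives. -/
theorem twistedDet_map_eval_zero :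
    φ.twistedDet.map (evalRingHom 0) = (Algebra.lmul 𝔽 F (γ X)).charpoly := by
  let b := Module.finBasis 𝔽 F
  let v := Algebra.TensorProduct.basis 𝔽[X] b
  rw [twistedDet_eq_charpoly, ← LinearMap.charpoly_toMatrix _ v, ← Matrix.charpoly_map,
    ← LinearMap.charpoly_toMatrix _ b]
  congr 1
  ext1 i a
  rw [Matrix.map_apply, LinearMap.toMatrix_apply, LinearMap.toMatrix_apply,
    Algebra.TensorProduct.basis_apply, twistedEnd, LinearMap.sum_apply, map_sum,
    Finsupp.finsetSum_apply, map_sum, Finset.sum_eq_single 0]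
  · simp [v, φ.coeff_zero]
  · intro j _ hj
    simp [hj]
  · simp

theorem eval_zero_coeffMap_twistedDet (hp : p.Monic) (hker : RingHom.ker γ = Ideal.span {p})
    (hdeg : p.natDegree = Module.finrank 𝔽 F) :
    (coeffMap 𝔽 F F[X] φ.twistedDet).eval 0 = p.map (algebraMap 𝔽 F) := by
  have h : (evalRingHom (0 : F[X])).comp (coeffMap 𝔽 F F[X]) =
      (mapRingHom (algebraMap 𝔽 F)).comp (mapRingHom (evalRingHom 0)) := by
    ext <;> simp [coeffMap]
  rw [← charpoly_lmul_eq hp hker hdeg, ← twistedDet_map_eval_zero]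
  exact congrArg (fun f : 𝔽[X][X] →+* F[X] => f φ.twistedDet) h

/-- Duality and the comparison of determinants make the Euler factor and the twisted determinant
proportional by factors free of `T`; these are determined at `T = 0`. -/
theorem eulerFactor_dual_motive (hp : p.Monic) (hker : RingHom.ker γ = Ideal.span {p})
    (hdeg : p.natDegree = Module.finrank 𝔽 F) :
    φ.motive.dual.eulerFactor hker hdeg =
      C (IsLocalization.Away.invSelf (p.map (algebraMap 𝔽 F))) *
        coeffMap 𝔽 F (AwayPrime F p) φ.twistedDet := by
  obtain ⟨u, hu⟩ := φ.associated_frobeniusCharpoly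
  -- A unit of `F[t][T]` is constant in `T`.
  obtain ⟨c, hc, hcu⟩ := Polynomial.isUnit_iff.1 u.isUnit
  rw [← hcu] at hu
  have h := φ.motive.det_mul_eulerFactor_dual hker hdeg
  rw [detSub_frobAway_motive φ hker hdeg, ← hu, Polynomial.map_mul, ← coeffMap_eq_map, Polynomial.map_C] at h
  -- At `T = 0` the Euler factor is `1`, so `det (-τ ^ d) = p c`. Substituting this back and
  -- cancelling the unit `c` leaves `p` times the Euler factor equal to the twisted determinant.
  have h₀ := congrArg (Polynomial.eval 0) h
  rw [Polynomial.eval_mul, Polynomial.eval_C, AndersonMotive.eval_zero_eulerFactor, mul_one,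
    Polynomial.eval_mul, Polynomial.eval_C, coeffMap_eq_map, Polynomial.eval_zero_map,
    eval_zero_coeffMap_twistedDet φ hp hker hdeg] at h₀
  rw [h₀, C_mul, mul_comm _ (C (algebraMap F[X] (AwayPrime F p) c)), mul_comm _
    (C (algebraMap F[X] (AwayPrime F p) c)), mul_assoc] at h
  have h₁ := ((hc.map (algebraMap F[X] (AwayPrime F p))).map C).mul_left_cancel h
  rw [← h₁, ← mul_assoc, ← C_mul, mul_comm (IsLocalization.Away.invSelf _),
    IsLocalization.Away.mul_invSelf, C_1, one_mul]

end DrinfeldModule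

end Dual

end Drinfeld

end

theorem mainTheorem11 {𝔽 F : Type*} [Field 𝔽] [Fintype 𝔽] [Field F] [Finite F] [Algebra 𝔽 F]
    (γ : 𝔽[X] →ₐ[𝔽] F) (p : 𝔽[X]) (hp : p.Monic) (hker : RingHom.ker γ = Ideal.span {p})
    (hdeg : p.natDegree = Module.finrank 𝔽 F) (φ : Drinfeld.DrinfeldModule γ) :
    Drinfeld.fittingIdeal 𝔽[X][X] φ.TwistedModule = Ideal.span {φ.twistedDet} ∧
    φ.motive.dual.eulerFactor hker hdeg =
      C (IsLocalization.Away.invSelf (p.map (algebraMap 𝔽 F))) *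
        Drinfeld.coeffMap 𝔽 F (Drinfeld.AwayPrime F p) φ.twistedDet ∧
    (Drinfeld.fittingIdeal 𝔽[X][X] φ.TwistedModule).map (Drinfeld.coeffMap 𝔽 F F[X]) =
      Ideal.span {φ.frobeniusCharpoly} :=
  ⟨φ.fittingIdeal_twistedModule, φ.eulerFactor_dual_motive hp hker hdeg,
    φ.map_fittingIdeal_twistedModule⟩
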